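/- Let $n\ge 1$ and let $\langle z,w\rangle=z_1\bar w_1+\dots+z_n\bar w_n-z_{n+1}\bar w_{n+1}$ on $\mathbb C^{n+1}$. Let $G=SU(n,1)$ be the group of matrices in $SL(n+1,\mathbb C)$ preserving this form. It acts on the unit ball $B^n\subset\mathbb C^n$ by $g(z)=(Az+b)/(cz+d)$, where $g=\begin{pmatrix}A&b\\c&d\end{pmatrix}$; put $j(g,z)=(cz+d)^{-1}$. Points $z,w$ of $\overline{B^n}$ are identified with the vectors $(z,1),(w,1)$ when they are inserted in $\langle\cdot,\cdot\rangle$. Let $dV=4^n\,dV_E/(1-|z|^2)^{n+1}$ be the invariant volume on $B^n$ ($dV_E$ is Lebesgue measure), and let $dg$ be the Haar measure on $G$ whose image under $g\mapsto g(0)$ is $dV$. Let $a_t\in G$ ($t\in\mathbb R$) be the identity on the first $n-1$ coordinates and $\begin{pmatrix}\cosh t&\sinh t\\ \sinh t&\cosh t\end{pmatrix}$ on the last two, and let $A=\{a_t\}$. Geodesics are the curves $t\mapsto g a_t(0)$, $g\in G$, and $t$ is the parameter of the geodesic flow. An element of $G$ is loxodromic if it is conjugate to an element of the centralizer of $A$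 which does not fix $0$; its axis is the geodesic that it maps to itself. Let $\Gamma$ be a lattice in $G$, and let $\kappa\ge 1$ with $2\kappa\in\mathbb Z$ and $m:=(n+1)\kappa\in\mathbb Z$. Write $(f|g)(z)=f(gz)\,j(g,z)^{2m}$ and $\tilde f(g)=f(g(0))\,j(g,0)^{2m}$. Let $S_{2m}(\Gamma)$ be the space of holomorphic $f:B^n\to\mathbb C$ with $f|\gamma=f$ for all $\gamma\in\Gamma$ and $\tilde f$ bounded. The Petersson product is $$(f_1,f_2)=\int_{\Gamma\backslash G}\tilde f_1\,\overline{\tilde f_2}\,dg .$$ When $\Gamma$ acts effectively on $B^n$, this equals $\int_{\Gamma\backslash B^n}f_1\overline{f_2}\,(1-|z|^2)^{2m}\,dV$. Let $\gamma_0\in\Gamma$ be loxodromic with repelling fixed point $X$ and attracting fixed point $Y$ in $\partial B^n$, so that $\gamma_0(Y,1)^T=\lambda(Y,1)^T$ and $\gamma_0(X,1)^T=\bar\lambda^{-1}(X,1)^T$ with $|\lambda|>1$. Put $Q_{\gamma_0}(z)=\langle z,X\rangle\langle z,Y\rangle$ and $q=Q_{\gamma_0}^{-m}$. Assume that $(\lambda/\bar\lambda)^{m}=1$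 (for instance, $\lambda$ is real, which is always so for $n=1$). **Theorem (period formula).** Then $q|\gamma_0=q$; with $\Gamma_0=\langle\gamma_0\rangle$, the series $$\Theta_{\gamma_0,\kappa}(z)=\sum_{\gamma\in\Gamma_0\backslash\Gamma}(q|\gamma)(z)$$ converges absolutely at every $z\in B^n$; and for every $f\in S_{2m}(\Gamma)$ and every point $z_0$ on the axis of $\gamma_0$, the integral $(f,\Theta_{\gamma_0,\kappa})$ converges absolutely and $$(f,\Theta_{\gamma_0,\kappa})=|\alpha|^{-2(n+1)\kappa}\,C\int_{z_0}^{\gamma_0z_0}f(z)\,Q_{\gamma_0}(z)^{(n+1)\kappa}\,dt,$$ where the integral is along the axis of $\gamma_0$, with $t$ increasing from $z_0$ to $\gamma_0z_0$, $\alpha=-\tfrac{\langle X,Y\rangle}{2}$ and $$C=\frac{(2(n+1)\kappa-n-1)!}{(((n+1)\kappa-1)!)^2}\,\pi^n\,2^{2(n+1)(1-\kappa)-1}.$$ If $\Gamma$ acts effectively on $B^n$, the formula also holds with $(f,\Theta_{\gamma_0,\kappa})$ computed as the integral over $\Gamma\backslash B^n$. -/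

import Mathlib

open MeasureTheory Filter Topology Matrix
open scoped ComplexConjugate Nat

noncomputable section

namespace ComplexHyperbolic

/-- The index set of `ℂ^{n,1}`: the `n` positive directions and the negative one. -/
abbrev Idx (n : ℕ) : Type := Fin n ⊕ Unit

/-- The Hermitian form `⟨z, w⟩ = z₁ w̄₁ + ⋯ + zₙ w̄ₙ - zₙ₊₁ w̄ₙ₊₁` on `ℂ^{n,1}`. -/
def herm {n : ℕ} (z w : Idx n → ℂ) : ℂ :=
  ∑ j : Fin n, z (Sum.inl j) * conj (w (Sum.inl j)) - z (Sum.inr ()) * conj (w (Sum.inr ()))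

/-- The group `SU(n,1)`. -/
def SU (n : ℕ) : Subgroup (SpecialLinearGroup (Idx n) ℂ) where
  carrier := {A | ∀ z w : Idx n → ℂ,
    herm ((A : Matrix (Idx n) (Idx n) ℂ) *ᵥ z) ((A : Matrix (Idx n) (Idx n) ℂ) *ᵥ w) = herm z w}
  mul_mem' := by
    intro A B hA hB z w
    have e : ∀ v : Idx n → ℂ, ((A * B : SpecialLinearGroup (Idx n) ℂ) : Matrix (Idx n) (Idx n) ℂ) *ᵥ v
        = (A : Matrix (Idx n) (Idx n) ℂ) *ᵥ ((B : Matrix (Idx n) (Idx n) ℂ) *ᵥ v) := fun v =>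
      (mulVec_mulVec v _ _).symm
    exact (congrArg₂ herm (e z) (e w)).trans ((hA _ _).trans (hB z w))
  one_mem' := by
    intro z w
    simp
  inv_mem' := by
    intro A hA z w
    have key : ∀ v : Idx n → ℂ, (A : Matrix (Idx n) (Idx n) ℂ) *ᵥ
        (((A⁻¹ : SpecialLinearGroup (Idx n) ℂ) : Matrix (Idx n) (Idx n) ℂ) *ᵥ v) = v := by
      intro v
      have h1 : (A : Matrix (Idx n) (Idx n) ℂ) *
          ((A⁻¹ : SpecialLinearGroup (Idx n) ℂ) : Matrix (Idx n) (Idx n) ℂ) = 1 :=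
        congrArg (fun B : SpecialLinearGroup (Idx n) ℂ => (B : Matrix (Idx n) (Idx n) ℂ))
          (mul_inv_cancel A)
      rw [mulVec_mulVec, h1, one_mulVec]
    exact (hA _ _).symm.trans (congrArg₂ herm (key z) (key w))

/-- The matrix of an element of `SU(n,1)`. -/
abbrev mat {n : ℕ} (g : SU n) : Matrix (Idx n) (Idx n) ℂ := (g : SpecialLinearGroup (Idx n) ℂ)

instance (n : ℕ) : MeasurableSpace (SU n) := borel _

instance (n : ℕ) : BorelSpace (SU n) := ⟨rfl⟩

/-- The open unit ball `Bⁿ` of `ℂⁿ`, for the Euclidean norm. -/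
abbrev Ball (n : ℕ) : Type := {z : Fin n → ℂ // ∑ j, ‖z j‖ ^ 2 < 1}

/-- The vector `(z, 1)` of `ℂ^{n,1}`. -/
def emb {n : ℕ} (z : Fin n → ℂ) : Idx n → ℂ := Sum.elim z (fun _ => 1)

theorem herm_self {n : ℕ} (v : Idx n → ℂ) :
    herm v v = ((∑ j : Fin n, ‖v (Sum.inl j)‖ ^ 2 - ‖v (Sum.inr ())‖ ^ 2 : ℝ) : ℂ) := by
  simp [herm, Complex.mul_conj']

theorem herm_emb_self {n : ℕ} (z : Fin n → ℂ) :
    herm (emb z) (emb z) = ((∑ j, ‖z j‖ ^ 2 - 1 : ℝ) : ℂ) := by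
  rw [herm_self]; simp [emb]

/-- The image of `(z, 1)` under `g` is again a negative vector. -/
theorem mat_emb_neg {n : ℕ} (g : SU n) (z : Ball n) :
    ∑ j : Fin n, ‖(mat g *ᵥ emb z.1) (Sum.inl j)‖ ^ 2
      < ‖(mat g *ᵥ emb z.1) (Sum.inr ())‖ ^ 2 := by
  have h := g.2 (emb z.1) (emb z.1)
  rw [herm_self, herm_emb_self] at h
  have h' := Complex.ofReal_injective h
  have := z.2
  linarith

theorem mat_emb_ne_zero {n : ℕ} (g : SU n) (z : Ball n) :
    (mat g *ᵥ emb z.1) (Sum.inr ()) ≠ 0 := by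
  intro h
  have h1 := mat_emb_neg g z
  rw [h] at h1
  have h2 : 0 ≤ ∑ j : Fin n, ‖(mat g *ᵥ emb z.1) (Sum.inl j)‖ ^ 2 :=
    Finset.sum_nonneg fun _ _ => by positivity
  simp at h1
  linarith

/-- The action of `g = (A b; c d)` on the ball: `g(z) = (A z + b) / (c z + d)`. -/
instance (n : ℕ) : SMul (SU n) (Ball n) where
  smul g z := ⟨fun i => (mat g *ᵥ emb z.1) (Sum.inl i) / (mat g *ᵥ emb z.1) (Sum.inr ()), by
    have h := mat_emb_neg g z
    have h0 : 0 < ‖(mat g *ᵥ emb z.1) (Sum.inr ())‖ ^ 2 := by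
      have := norm_pos_iff.mpr (mat_emb_ne_zero g z)
      positivity
    simp only [norm_div, div_pow]
    rw [← Finset.sum_div, div_lt_one h0]
    exact h⟩

theorem smul_apply {n : ℕ} (g : SU n) (z : Ball n) (i : Fin n) :
    (g • z).1 i = (mat g *ᵥ emb z.1) (Sum.inl i) / (mat g *ᵥ emb z.1) (Sum.inr ()) := rfl

theorem mat_emb {n : ℕ} (g : SU n) (z : Ball n) :
    mat g *ᵥ emb z.1 = (mat g *ᵥ emb z.1) (Sum.inr ()) • emb (g • z).1 := by
  have h0 := mat_emb_ne_zero g z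
  funext i
  rcases i with i | i
  · simp only [Pi.smul_apply, smul_eq_mul, emb, Sum.elim_inl]
    rw [smul_apply]
    simp only [emb] at h0 ⊢
    field_simp
  · simp [emb]

instance (n : ℕ) : MulAction (SU n) (Ball n) where
  one_smul z := by
    apply Subtype.ext
    funext i
    rw [smul_apply]
    simp [mat, emb]
  mul_smul g h z := by
    apply Subtype.ext
    funext i
    have e : mat (g * h) *ᵥ emb z.1
        = (mat h *ᵥ emb z.1) (Sum.inr ()) • (mat g *ᵥ emb (h • z).1) := by
      have : mat (g * h) = mat g * mat h := rfl
      rw [this, ← mulVec_mulVec, mat_emb h z, mulVec_smul]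
      simp [emb]
    rw [smul_apply, smul_apply, e]
    simp only [Pi.smul_apply, smul_eq_mul]
    rw [mul_div_mul_left _ _ (mat_emb_ne_zero h z)]

/-- The centre `0` of the ball. -/
def origin (n : ℕ) : Ball n := ⟨0, by simp⟩

/-- The automorphy factor `j(g, z) = (c z + d)⁻¹`. -/
def autFactor {n : ℕ} (g : SU n) (z : Ball n) : ℂ := ((mat g *ᵥ emb z.1) (Sum.inr ()))⁻¹

/-- The operator `(f|g)(z) = f(g z) j(g, z)^k`. -/
def slash {n : ℕ} (k : ℕ) (f : Ball n → ℂ) (g : SU n) (z : Ball n) : ℂ :=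
  f (g • z) * autFactor g z ^ k

/-- The lift `f̃(g) = f(g(0)) j(g, 0)^k` of a function on the ball to the group. -/
def lift {n : ℕ} (k : ℕ) (f : Ball n → ℂ) (g : SU n) : ℂ :=
  f (g • origin n) * autFactor g (origin n) ^ k

/-- The invariant volume `dV = 4ⁿ dV_E / (1 - |z|²)^{n+1}` on the ball, where `dV_E` is
Lebesgue measure on `ℂⁿ = ℝ²ⁿ`. -/
def hypVolume (n : ℕ) : Measure (Ball n) :=
  (Measure.comap Subtype.val (volume : Measure (Fin n → ℂ))).withDensity
    fun z => ENNReal.ofReal (4 ^ n / (1 - ∑ j, ‖z.1 j‖ ^ 2) ^ (n + 1))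

/-- `Γ` is a lattice: a discrete subgroup such that `Γ \ G` has finite Haar measure. -/
def IsLattice {n : ℕ} (μ : Measure (SU n)) (Γ : Subgroup (SU n)) : Prop :=
  DiscreteTopology Γ ∧ ∃ D : Set (SU n), IsFundamentalDomain Γ D μ ∧ μ D ≠ ⊤

/-- Holomorphic cusp forms of weight `k` for `Γ`: holomorphic functions on the ball with
`f|γ = f` for `γ ∈ Γ` whose lift to the group is bounded. -/
structure IsCuspForm {n : ℕ} (Γ : Subgroup (SU n)) (k : ℕ) (f : Ball n → ℂ) : Prop where
  holomorphic : ∃ F : (Fin n → ℂ) → ℂ,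
    DifferentiableOn ℂ F {z | ∑ j, ‖z j‖ ^ 2 < 1} ∧ ∀ z : Ball n, f z = F z.1
  slash_eq : ∀ γ ∈ Γ, slash k f γ = f
  bounded : ∃ M : ℝ, ∀ g : SU n, ‖lift k f g‖ ≤ M

/-- The last coordinate of `ℂⁿ`. -/
def lastIdx (n : ℕ) [NeZero n] : Fin n := ⟨n - 1, Nat.sub_lt (NeZero.pos n) one_pos⟩

/-- The matrix of `aₜ`: the identity on the first `n - 1` coordinates, and the block
`(cosh t, sinh t; sinh t, cosh t)` on the last two. -/
def flowMatrix (n : ℕ) [NeZero n] (t : ℝ) : Matrix (Idx n) (Idx n) ℂ :=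
  fromBlocks (diagonal (Function.update 1 (lastIdx n) (Complex.cosh t)))
    (of fun i _ => if i = lastIdx n then Complex.sinh t else 0)
    (of fun _ j => if j = lastIdx n then Complex.sinh t else 0)
    (diagonal fun _ => Complex.cosh t)

theorem flowMatrix_mulVec_inl (n : ℕ) [NeZero n] (t : ℝ) (z : Idx n → ℂ) (i : Fin n) :
    (flowMatrix n t *ᵥ z) (Sum.inl i) = if i = lastIdx n then
      Complex.cosh t * z (Sum.inl i) + Complex.sinh t * z (Sum.inr ()) else z (Sum.inl i) := by
  by_cases h : i = lastIdx n
  · simp [flowMatrix, mulVec, dotProduct, Fintype.sum_sum_type, diagonal_apply, h]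
  · simp [flowMatrix, mulVec, dotProduct, Fintype.sum_sum_type, diagonal_apply, h]

theorem flowMatrix_mulVec_inr (n : ℕ) [NeZero n] (t : ℝ) (z : Idx n → ℂ) :
    (flowMatrix n t *ᵥ z) (Sum.inr ()) =
      Complex.sinh t * z (Sum.inl (lastIdx n)) + Complex.cosh t * z (Sum.inr ()) := by
  simp [flowMatrix, mulVec, dotProduct, Fintype.sum_sum_type]

theorem det_flowMatrix (n : ℕ) [NeZero n] (t : ℝ) : (flowMatrix n t).det = 1 := by
  have hc : (Complex.cosh t) ≠ 0 := by
    rw [← Complex.ofReal_cosh]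
    exact_mod_cast (Real.cosh_pos t).ne'
  have hu : IsUnit (diagonal (fun _ : Unit => Complex.cosh (t : ℂ))) := by
    rw [isUnit_iff_isUnit_det]; simpa using hc
  let := hu.invertible
  have hS : diagonal (Function.update 1 (lastIdx n) (Complex.cosh (t : ℂ)))
      - (Matrix.of fun (i : Fin n) (_ : Unit) => if i = lastIdx n then Complex.sinh (t : ℂ) else 0) *
        ⅟(diagonal (fun _ : Unit => Complex.cosh (t : ℂ))) *
        (Matrix.of fun (_ : Unit) (j : Fin n) => if j = lastIdx n then Complex.sinh (t : ℂ) else 0)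
      = diagonal (Function.update 1 (lastIdx n) (Complex.cosh (t : ℂ))⁻¹) := by
    have hsq := Complex.cosh_sq_sub_sinh_sq (t : ℂ)
    ext i j
    rw [invOf_eq_nonsing_inv, inv_def, Matrix.sub_apply, mul_apply]
    simp only [Finset.univ_unique, mul_apply, Finset.sum_singleton]
    by_cases hi : i = lastIdx n <;> by_cases hj : j = lastIdx n
    · subst hi; subst hj
      simp
      field_simp
      linear_combination hsq
    · subst hi
      simp [hj, Ne.symm hj]
    · subst hj
      simp [hi]
    · simp [hi, hj, diagonal_apply]
  unfold flowMatrix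
  refine (det_fromBlocks₂₂ _ _ _ _).trans ?_
  refine (congrArg (fun M => det (diagonal (fun _ : Unit => Complex.cosh (t : ℂ))) * det M)
    hS).trans ?_
  simp only [det_diagonal]
  rw [Finset.prod_update_of_mem (Finset.mem_univ _)]
  simp [hc]

/-- The element `aₜ` of `SU(n,1)`. -/
def flow (n : ℕ) [NeZero n] (t : ℝ) : SU n :=
  ⟨⟨flowMatrix n t, det_flowMatrix n t⟩, by
    intro z w
    have hsq := Complex.cosh_sq_sub_sinh_sq (t : ℂ)
    have hc : conj (Complex.cosh (t : ℂ)) = Complex.cosh t := by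
      rw [← Complex.cosh_conj, Complex.conj_ofReal]
    have hs : conj (Complex.sinh (t : ℂ)) = Complex.sinh t := by
      rw [← Complex.sinh_conj, Complex.conj_ofReal]
    simp only [herm, flowMatrix_mulVec_inl, flowMatrix_mulVec_inr]
    rw [← Finset.add_sum_erase _ _ (Finset.mem_univ (lastIdx n)),
      ← Finset.add_sum_erase Finset.univ (fun j => z (Sum.inl j) * conj (w (Sum.inl j)))
        (Finset.mem_univ (lastIdx n)),
      Finset.sum_congr rfl (g := fun j => z (Sum.inl j) * conj (w (Sum.inl j)))
        (fun j hj => by rw [if_neg (Finset.ne_of_mem_erase hj), if_neg (Finset.ne_of_mem_erase hj)])]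
    simp only [if_true, map_add, map_mul, hc, hs]
    linear_combination (z (Sum.inl (lastIdx n)) * conj (w (Sum.inl (lastIdx n)))
      - z (Sum.inr ()) * conj (w (Sum.inr ()))) * hsq⟩

/-- The standard geodesic `{aₜ(0)}`. -/
def stdGeodesic (n : ℕ) [NeZero n] : Set (Ball n) := Set.range fun t : ℝ => flow n t • origin n

/-- `g` is loxodromic: it is conjugate to an element of the centralizer `Z(A) = AW` of
`A = {aₜ}` that does not lie in the compact part `W`, that is, which moves the point `0`. -/
def IsLoxodromic {n : ℕ} [NeZero n] (g : SU n) : Prop :=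
  ∃ h : SU n, ∃ c ∈ Subgroup.centralizer (Set.range (flow n)),
    c • origin n ≠ origin n ∧ g = h * c * h⁻¹

/-- `L` is an axis of `g`: a geodesic (a translate of the standard one) which `g` maps onto
itself. -/
def IsAxis {n : ℕ} [NeZero n] (g : SU n) (L : Set (Ball n)) : Prop :=
  (∃ h : SU n, L = (fun z => h • z) '' stdGeodesic n) ∧ (fun z => g • z) '' L = L

/-- `Q(z) = ⟨z, X⟩ ⟨z, Y⟩`. -/
def quad {n : ℕ} (X Y : Fin n → ℂ) (z : Ball n) : ℂ :=
  herm (emb z.1) (emb X) * herm (emb z.1) (emb Y)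

/-- `q(z) = 1 / Q(z)^m`. -/
def seed {n : ℕ} (m : ℕ) (X Y : Fin n → ℂ) (z : Ball n) : ℂ := (quad X Y z ^ m)⁻¹

/-- The coset space `Γ₀ \ Γ` of right cosets `Γ₀ γ`, where `Γ₀` is generated by `γ₀`. -/
abbrev Cosets {n : ℕ} {Γ : Subgroup (SU n)} (γ₀ : Γ) : Type :=
  Quotient (QuotientGroup.rightRel (Subgroup.zpowers γ₀))

/-- The relative Poincaré series `∑_{γ ∈ Γ₀ \ Γ} (q|γ)(z)` of weight `k`. -/
def relPoincare {n : ℕ} {Γ : Subgroup (SU n)} (γ₀ : Γ) (k : ℕ) (q : Ball n → ℂ)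
    (z : Ball n) : ℂ :=
  ∑' c : Cosets γ₀, slash k q (c.out : SU n) z

/-- The constant `C = (2m - n - 1)! / ((m - 1)!)² · πⁿ · 2^{2(n+1)(1-κ) - 1}`, where
`m = (n+1)κ`. -/
def periodConst (n : ℕ) (κ : ℚ) (m : ℕ) : ℝ :=
  ((2 * m - n - 1)! : ℝ) / ((m - 1)! : ℝ) ^ 2 * Real.pi ^ n
    * (2 : ℝ) ^ (2 * (n + 1) * (1 - (κ : ℝ)) - 1)

end ComplexHyperbolic

end

/-! The proof is Rankin–Selberg unfolding followed by an explicit integral over a slab of the ball.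
Since `f̃` is `Γ`-invariant, it can be moved inside the sum defining `Θ`, and the sum over `Γ₀ \ Γ`
of integrals over a fundamental domain of `Γ` becomes one integral of `f̃ · conj q̃` over a
fundamental domain of `Γ₀` (`setIntegral_tsum_out`). Such a domain is a level slab of `log (|⟨z,X⟩|
/ |⟨z,Y⟩|)`, because `γ₀` raises this function by `2 log |λ|` (`heightLog_smul`). On the slab `q` is
bounded, and `κ ≥ 1` gives `m ≥ n + 1`, so `q̃` is integrable there (`integrableOn_lift_seed`). This
also gives absolute convergence of `Θ`: it converges almost everywhere on a set of positive measure,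
hence at one point, and the terms at two points of the ball are comparable uniformly in the coset
(`exists_norm_slash_seed_le`).

To evaluate the integral, translate by `g` so that the axis is the standard diameter
(`exists_axis_normal_form`). Then `q` becomes a multiple of `(1 - w²)^{-m}` and the slab becomes a
condition on `w`, where `w` is the last coordinate. The other coordinates enter only through the
holomorphic function and through `|z|²`. The mean value property replaces the function by its value
on the disc, and a Beta integral removes those coordinates (`setIntegral_unitBall_eq_disc`).

On the disc put `w = tanh ζ` with `|Im ζ| < π/4`. The integrand becomes `H(ζ) cos(2 Im ζ)^{2m-2}` on
a rectangle, where `H(ζ) = F(tanh ζ) cosh(ζ)^{-2m}` is holomorphic. The invariance `f|γ₀ = f` makes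
`H` periodic with period `s`, the translation length; here `(λ/λ̄)^m = 1` is what removes the phase
of `λ`. By Cauchy's theorem the integral of `H` over a horizontal period does not depend on the
height, so the double integral is a Wallis integral times `∫₀ˢ H(t) dt` (`setIntegral_disc_eq`), and
the latter is the period of `f Q^m` along the axis (`integral_axis`). The constant collects `4ⁿ`,
the Beta integral and the Wallis integral (`stdPeriodConst_eq`). -/

noncomputable section

namespace ComplexHyperbolic

/-! ### The Hermitian form, automorphy factors, and comparison estimates for null vectors. -/

section Hermitian

variable {n : ℕ}

theorem herm_add_left (u v w : Idx n → ℂ) : herm (u + v) w = herm u w + herm v w := by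
  simp only [herm, Pi.add_apply, add_mul, Finset.sum_add_distrib]
  ring

theorem herm_smul_left (a : ℂ) (v w : Idx n → ℂ) : herm (a • v) w = a * herm v w := by
  simp only [herm, Pi.smul_apply, smul_eq_mul, mul_sub, Finset.mul_sum, mul_assoc]

theorem conj_herm (v w : Idx n → ℂ) : conj (herm v w) = herm w v := by
  simp [herm, mul_comm]

theorem herm_smul_right (a : ℂ) (v w : Idx n → ℂ) : herm v (a • w) = conj a * herm v w := by
  rw [← conj_herm, herm_smul_left, map_mul, conj_herm]

theorem herm_add_right (u v w : Idx n → ℂ) : herm u (v + w) = herm u v + herm u w := by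
  rw [← conj_herm, herm_add_left, map_add, conj_herm, conj_herm]

theorem herm_mat (g : SU n) (v w : Idx n → ℂ) : herm (mat g *ᵥ v) (mat g *ᵥ w) = herm v w :=
  g.2 v w

theorem mat_mul_mulVec (g h : SU n) (v : Idx n → ℂ) :
    mat (g * h) *ᵥ v = mat g *ᵥ (mat h *ᵥ v) :=
  (mulVec_mulVec v (mat g) (mat h)).symm

theorem mat_one_mulVec (v : Idx n → ℂ) : mat (1 : SU n) *ᵥ v = v := by
  simp [mat]

theorem herm_mat_left (g : SU n) (v w : Idx n → ℂ) :
    herm (mat g *ᵥ v) w = herm v (mat g⁻¹ *ᵥ w) := by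
  conv_lhs => rw [← mat_one_mulVec w, ← mul_inv_cancel g, mat_mul_mulVec, herm_mat]

theorem mat_smul_emb (g : SU n) (z : Ball n) :
    emb (g • z).1 = autFactor g z • (mat g *ᵥ emb z.1) := by
  rw [mat_emb g z, smul_smul, autFactor, inv_mul_cancel₀ (mat_emb_ne_zero g z), one_smul]

theorem autFactor_ne_zero (g : SU n) (z : Ball n) : autFactor g z ≠ 0 :=
  inv_ne_zero (mat_emb_ne_zero g z)

theorem autFactor_mul (g h : SU n) (z : Ball n) :
    autFactor (g * h) z = autFactor g (h • z) * autFactor h z := by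
  simp only [autFactor]
  rw [mat_mul_mulVec, mat_emb h z, mulVec_smul]
  simp [emb, mul_comm]

theorem slash_mul (k : ℕ) (f : Ball n → ℂ) (g h : SU n) :
    slash k f (g * h) = slash k (slash k f g) h := by
  funext z
  simp only [slash, autFactor_mul, mul_smul, mul_pow]
  ring

theorem lift_mul (k : ℕ) (f : Ball n → ℂ) (g x : SU n) :
    lift k f (g * x) = lift k (slash k f g) x := by
  simp only [lift, slash, autFactor_mul, mul_smul, mul_pow]
  ring

/-- Compare the value of the form on `(g(0), 1) = j(g,0) · g(0, 1)` with its value on `(0, 1)`. This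
identity turns products of lifts into the Petersson integrand on the ball. -/
theorem norm_autFactor_sq (g : SU n) :
    ‖autFactor g (origin n)‖ ^ 2 = 1 - ∑ j, ‖(g • origin n).1 j‖ ^ 2 := by
  have h := herm_emb_self (g • origin n).1
  rw [mat_smul_emb, herm_smul_left, herm_smul_right, herm_mat, herm_emb_self, ← mul_assoc,
    Complex.mul_conj'] at h
  have h2 : ‖autFactor g (origin n)‖ ^ 2 * (∑ j, ‖(origin n).1 j‖ ^ 2 - 1) =
      ∑ j, ‖(g • origin n).1 j‖ ^ 2 - 1 := by exact_mod_cast h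
  simp [origin] at h2 ⊢
  linarith

theorem lift_mul_conj_lift (m : ℕ) (f q : Ball n → ℂ) (x : SU n) :
    lift (2 * m) f x * conj (lift (2 * m) q x) =
      f (x • origin n) * conj (q (x • origin n)) *
        ((1 - ∑ j, ‖(x • origin n).1 j‖ ^ 2 : ℝ) : ℂ) ^ (2 * m) := by
  rw [← norm_autFactor_sq]
  simp only [lift, map_mul, map_pow]
  rw [Complex.ofReal_pow, ← Complex.mul_conj', mul_pow]
  ring

theorem norm_lift (m : ℕ) (f : Ball n → ℂ) (x : SU n) :
    ‖lift (2 * m) f x‖ = ‖f (x • origin n)‖ * (1 - ∑ j, ‖(x • origin n).1 j‖ ^ 2) ^ m := by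
  rw [lift, norm_mul, norm_pow, pow_mul, norm_autFactor_sq]

theorem quad_smul (X Y : Fin n → ℂ) (g : SU n) (z : Ball n) :
    quad X Y (g • z) = autFactor g z ^ 2 *
      (herm (mat g *ᵥ emb z.1) (emb X) * herm (mat g *ᵥ emb z.1) (emb Y)) := by
  simp only [quad, mat_smul_emb, herm_smul_left]
  ring

/-- `Q` is homogeneous of degree 2 in the vector `(z, 1)`, so weight `2m` cancels the automorphy
factor exactly. -/
theorem slash_seed (m : ℕ) (X Y : Fin n → ℂ) (g : SU n) (z : Ball n) :
    slash (2 * m) (seed m X Y) g z =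
      ((herm (mat g *ᵥ emb z.1) (emb X) * herm (mat g *ᵥ emb z.1) (emb Y)) ^ m)⁻¹ := by
  have h := autFactor_ne_zero g z
  rw [slash, seed, quad_smul, mul_pow, mul_inv, ← pow_mul, mul_right_comm,
    inv_mul_cancel₀ (pow_ne_zero _ h), one_mul]

theorem quad_pow_mul_autFactor (m : ℕ) (f : Ball n → ℂ) (X Y : Fin n → ℂ) (g : SU n) (z : Ball n) :
    f (g • z) * quad X Y (g • z) ^ m = slash (2 * m) f g z *
      (herm (mat g *ᵥ emb z.1) (emb X) * herm (mat g *ᵥ emb z.1) (emb Y)) ^ m := by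
  rw [quad_smul, slash, mul_pow, ← pow_mul, mul_assoc]

theorem norm_inl_sq_of_null {v : Idx n → ℂ} (hv : herm v v = 0) :
    ∑ j : Fin n, ‖v (Sum.inl j)‖ ^ 2 = ‖v (Sum.inr ())‖ ^ 2 := by
  rw [herm_self, Complex.ofReal_eq_zero] at hv
  linarith

theorem norm_sum_mul_conj_le (p v : Idx n → ℂ) :
    ‖∑ j : Fin n, p (Sum.inl j) * conj (v (Sum.inl j))‖ ≤
      √(∑ j : Fin n, ‖p (Sum.inl j)‖ ^ 2) * √(∑ j : Fin n, ‖v (Sum.inl j)‖ ^ 2) := by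
  refine (norm_sum_le _ _).trans ?_
  simp only [norm_mul, RCLike.norm_conj]
  exact Real.sum_mul_le_sqrt_mul_sqrt _ _ _

theorem norm_herm_le_of_null (p : Idx n → ℂ) {v : Idx n → ℂ} (hv : herm v v = 0) :
    ‖herm p v‖ ≤ (√(∑ j : Fin n, ‖p (Sum.inl j)‖ ^ 2) + ‖p (Sum.inr ())‖) * ‖v (Sum.inr ())‖ := by
  have h := norm_sum_mul_conj_le p v
  rw [norm_inl_sq_of_null hv, Real.sqrt_sq (norm_nonneg _)] at h
  refine (norm_sub_le _ _).trans ?_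
  rw [norm_mul, RCLike.norm_conj, add_mul]
  gcongr

/-- The positive part of a null vector has the same norm as its last coordinate; Cauchy–Schwarz then
bounds `|⟨p, v⟩|` from below. The bound is useful when `p` is negative. -/
theorem le_norm_herm_of_null (p : Idx n → ℂ) {v : Idx n → ℂ} (hv : herm v v = 0) :
    (‖p (Sum.inr ())‖ - √(∑ j : Fin n, ‖p (Sum.inl j)‖ ^ 2)) * ‖v (Sum.inr ())‖ ≤ ‖herm p v‖ := by
  have h := norm_sum_mul_conj_le p v
  rw [norm_inl_sq_of_null hv, Real.sqrt_sq (norm_nonneg _)] at h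
  have h2 := norm_sub_norm_le (p (Sum.inr ()) * conj (v (Sum.inr ())))
    (∑ j : Fin n, p (Sum.inl j) * conj (v (Sum.inl j)))
  rw [norm_mul, RCLike.norm_conj, norm_sub_rev] at h2
  rw [sub_mul, herm]
  linarith

theorem sqrt_sum_lt_of_neg {p : Idx n → ℂ}
    (hp : ∑ j : Fin n, ‖p (Sum.inl j)‖ ^ 2 < ‖p (Sum.inr ())‖ ^ 2) :
    √(∑ j : Fin n, ‖p (Sum.inl j)‖ ^ 2) < ‖p (Sum.inr ())‖ := by
  rw [Real.sqrt_lt' ]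
  · exact hp
  · by_contra h
    have h0 : ‖p (Sum.inr ())‖ = 0 := le_antisymm (not_lt.mp h) (norm_nonneg _)
    rw [h0] at hp
    have : 0 ≤ ∑ j : Fin n, ‖p (Sum.inl j)‖ ^ 2 := Finset.sum_nonneg fun _ _ => by positivity
    norm_num at hp
    linarith

theorem eq_zero_of_null_of_inr {v : Idx n → ℂ} (hv : herm v v = 0) (h : v (Sum.inr ()) = 0) :
    v = 0 := by
  have h1 := norm_inl_sq_of_null hv
  rw [h, norm_zero, zero_pow two_ne_zero,
    Finset.sum_eq_zero_iff_of_nonneg (fun _ _ => by positivity)] at h1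
  funext i
  rcases i with i | i
  · simpa using h1 i (Finset.mem_univ i)
  · exact h

theorem herm_ne_zero_of_neg_of_null {p v : Idx n → ℂ}
    (hp : ∑ j : Fin n, ‖p (Sum.inl j)‖ ^ 2 < ‖p (Sum.inr ())‖ ^ 2) (hv : herm v v = 0)
    (h0 : v ≠ 0) : herm p v ≠ 0 := by
  have h1 : v (Sum.inr ()) ≠ 0 := fun h => h0 (eq_zero_of_null_of_inr hv h)
  have h2 := le_norm_herm_of_null p hv
  have h3 := sqrt_sum_lt_of_neg hp
  have h4 := norm_pos_iff.mpr h1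
  exact norm_pos_iff.mp ((mul_pos (sub_pos.mpr h3) h4).trans_le h2)

/-- `C` is independent of `v`: both sides are comparable to `|v (inr ())|`. This uniformity lets a
bound on the Poincaré series pass from one point of the ball to another. -/
theorem exists_norm_herm_le_mul {p : Idx n → ℂ}
    (hp : ∑ j : Fin n, ‖p (Sum.inl j)‖ ^ 2 < ‖p (Sum.inr ())‖ ^ 2) (p' : Idx n → ℂ) :
    ∃ C : ℝ, 0 ≤ C ∧ ∀ v : Idx n → ℂ, herm v v = 0 → ‖herm p' v‖ ≤ C * ‖herm p v‖ := by
  have h3 := sub_pos.mpr (sqrt_sum_lt_of_neg hp)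
  refine ⟨(√(∑ j : Fin n, ‖p' (Sum.inl j)‖ ^ 2) + ‖p' (Sum.inr ())‖) /
    (‖p (Sum.inr ())‖ - √(∑ j : Fin n, ‖p (Sum.inl j)‖ ^ 2)), by positivity, fun v hv => ?_⟩
  refine (norm_herm_le_of_null p' hv).trans ?_
  rw [div_mul_eq_mul_div, le_div_iff₀ h3, mul_assoc]
  gcongr
  rw [mul_comm]
  exact le_norm_herm_of_null p hv

/-- Signature `(n, 1)` admits no isotropic plane: the combination of `u` and `v` with zero last
coordinate is still null, hence zero. -/
theorem exists_eq_smul_of_null {u v : Idx n → ℂ} (hu : herm u u = 0) (hv : herm v v = 0)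
    (huv : herm u v = 0) (h0 : v ≠ 0) : ∃ a : ℂ, u = a • v := by
  have h1 : v (Sum.inr ()) ≠ 0 := fun h => h0 (eq_zero_of_null_of_inr hv h)
  have hvu : herm v u = 0 := by rw [← conj_herm, huv, map_zero]
  refine ⟨u (Sum.inr ()) / v (Sum.inr ()), ?_⟩
  have : u + (-(u (Sum.inr ()) / v (Sum.inr ()))) • v = 0 := by
    apply eq_zero_of_null_of_inr
    · simp only [herm_add_left, herm_add_right, herm_smul_left, herm_smul_right, hu, hv, huv, hvu,
        mul_zero, add_zero]
    · simp [h1]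
  rw [neg_smul] at this
  exact eq_of_sub_eq_zero (by rwa [sub_eq_add_neg])

theorem emb_ne_zero (z : Fin n → ℂ) : emb z ≠ 0 := fun h => by
  simpa [emb] using congrFun h (Sum.inr ())

theorem emb_null {X : Fin n → ℂ} (hX : ∑ j, ‖X j‖ ^ 2 = 1) : herm (emb X) (emb X) = 0 := by
  rw [herm_emb_self, hX]; simp

theorem emb_neg (z : Ball n) :
    ∑ j : Fin n, ‖emb z.1 (Sum.inl j)‖ ^ 2 < ‖emb z.1 (Sum.inr ())‖ ^ 2 := by
  simpa [emb] using z.2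

theorem exists_norm_slash_seed_le (m : ℕ) {X Y : Fin n → ℂ} (hX : ∑ j, ‖X j‖ ^ 2 = 1)
    (hY : ∑ j, ‖Y j‖ ^ 2 = 1) (z w : Ball n) :
    ∃ C : ℝ, ∀ g : SU n, ‖slash (2 * m) (seed m X Y) g z‖ ≤
      C * ‖slash (2 * m) (seed m X Y) g w‖ := by
  obtain ⟨C, hC0, hC⟩ := exists_norm_herm_le_mul (emb_neg z) (emb w.1)
  refine ⟨(C * C) ^ m, fun g => ?_⟩
  have key : ∀ X : Fin n → ℂ, ∑ j, ‖X j‖ ^ 2 = 1 →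
      ‖herm (mat g *ᵥ emb w.1) (emb X)‖ ≤ C * ‖herm (mat g *ᵥ emb z.1) (emb X)‖ ∧
      herm (mat g *ᵥ emb w.1) (emb X) ≠ 0 ∧ herm (mat g *ᵥ emb z.1) (emb X) ≠ 0 := by
    intro X hX
    refine ⟨?_, herm_ne_zero_of_neg_of_null (mat_emb_neg g w) (emb_null hX) (emb_ne_zero X),
      herm_ne_zero_of_neg_of_null (mat_emb_neg g z) (emb_null hX) (emb_ne_zero X)⟩
    -- Moving `g` to the other side produces the null vector `g⁻¹(X, 1)`, to which the uniform
    -- comparison applies.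
    rw [herm_mat_left, herm_mat_left]
    exact hC _ (by rw [herm_mat, emb_null hX])
  obtain ⟨hX1, hX2, hX3⟩ := key X hX
  obtain ⟨hY1, hY2, hY3⟩ := key Y hY
  rw [slash_seed, slash_seed, norm_inv, norm_inv, norm_pow, norm_pow, norm_mul, norm_mul,
    ← inv_pow, ← inv_pow, ← mul_pow]
  have a1 := norm_pos_iff.mpr hX2
  have a2 := norm_pos_iff.mpr hX3
  have a3 := norm_pos_iff.mpr hY2
  have a4 := norm_pos_iff.mpr hY3
  gcongr
  rw [← div_eq_mul_inv, le_div_iff₀ (by positivity), inv_mul_le_iff₀ (by positivity)]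
  calc _ ≤ _ := mul_le_mul hX1 hY1 (by positivity) (by positivity)
    _ = _ := by ring

end Hermitian

/-! ### The standard geodesic and the normal form of a loxodromic element along its axis. -/

section Axis

variable {n : ℕ} [NeZero n]

/-- The vector of `ℂ^{n,1}` with last two coordinates `a`, `b` and all others zero. -/
def diskVec (n : ℕ) [NeZero n] (a b : ℂ) : Idx n → ℂ :=
  Sum.elim (Pi.single (lastIdx n) a) fun _ => b

theorem emb_single (w : ℂ) : emb (Pi.single (lastIdx n) w) = diskVec n w 1 := rfl

theorem emb_origin : emb (origin n).1 = diskVec n 0 1 := by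
  simp [origin, diskVec, emb]

theorem smul_diskVec (c a b : ℂ) : c • diskVec n a b = diskVec n (c * a) (c * b) := by
  funext i
  rcases i with i | i
  · by_cases h : i = lastIdx n
    · subst h; simp [diskVec]
    · simp [diskVec, h]
  · simp [diskVec]

theorem diskVec_add (a b a' b' : ℂ) :
    diskVec n a b + diskVec n a' b' = diskVec n (a + a') (b + b') := by
  funext i
  rcases i with i | i
  · by_cases h : i = lastIdx n
    · subst h; simp [diskVec]
    · simp [diskVec, h]
  · simp [diskVec]

theorem herm_diskVec_right (v : Idx n → ℂ) (a b : ℂ) :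
    herm v (diskVec n a b) = v (Sum.inl (lastIdx n)) * conj a - v (Sum.inr ()) * conj b := by
  rw [herm, Finset.sum_eq_single (lastIdx n)]
  · simp [diskVec]
  · intro j _ hj; simp [diskVec, hj]
  · simp

theorem herm_diskVec (a b a' b' : ℂ) :
    herm (diskVec n a b) (diskVec n a' b') = a * conj a' - b * conj b' := by
  rw [herm_diskVec_right]; simp [diskVec]

theorem flow_mulVec_diskVec (t : ℝ) (a b : ℂ) : mat (flow n t) *ᵥ diskVec n a b =
    diskVec n (Complex.cosh t * a + Complex.sinh t * b)
      (Complex.sinh t * a + Complex.cosh t * b) := by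
  funext i
  rcases i with i | i
  · refine (flowMatrix_mulVec_inl n t _ i).trans ?_
    by_cases h : i = lastIdx n
    · subst h; simp [diskVec]
    · simp [diskVec, h]
  · refine (flowMatrix_mulVec_inr n t _).trans ?_
    simp [diskVec]

theorem flow_smul_origin (t : ℝ) :
    (flow n t • origin n).1 = Pi.single (lastIdx n) (Real.tanh t : ℂ) := by
  funext i
  rw [smul_apply, emb_origin, flow_mulVec_diskVec]
  by_cases h : i = lastIdx n
  · subst h; simp [diskVec, Complex.tanh_eq_sinh_div_cosh]
  · simp [diskVec, h]

theorem flow_add (s t : ℝ) : flow n (s + t) = flow n s * flow n t := by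
  apply Subtype.ext
  apply Subtype.ext
  change flowMatrix n (s + t : ℝ) = flowMatrix n s * flowMatrix n t
  apply ext_of_mulVec_single
  intro i
  rw [← mulVec_mulVec]
  generalize (Pi.single i 1 : Idx n → ℂ) = v
  funext j
  rcases j with j | j
  · simp only [flowMatrix_mulVec_inl, flowMatrix_mulVec_inr, Complex.ofReal_add, Complex.cosh_add,
      Complex.sinh_add]
    by_cases h : j = lastIdx n
    · subst h; simp only [if_true]; ring
    · simp only [h, if_false]
  · refine (flowMatrix_mulVec_inr n _ v).trans
      (Eq.trans ?_ (flowMatrix_mulVec_inr n s (flowMatrix n t *ᵥ v)).symm)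
    simp only [flowMatrix_mulVec_inl, flowMatrix_mulVec_inr, Complex.ofReal_add, Complex.cosh_add,
      Complex.sinh_add, if_true]
    ring

theorem flow_zero : flow n 0 = 1 := by
  have h := flow_add (n := n) 0 0
  rw [add_zero] at h
  exact left_eq_mul.mp h

theorem flow_neg (t : ℝ) : flow n (-t) = (flow n t)⁻¹ := by
  rw [eq_inv_iff_mul_eq_one, ← flow_add, neg_add_cancel, flow_zero]

/-- An isometry that fixes `0` and sends another point of the diameter into the diameter preserves
the plane of the last two coordinates. On it, up to the phase `δ`, it is the identity or the
reflection of the diameter at `0`. -/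
theorem exists_mulVec_diskVec_of_fixes {k : SU n} (h0 : k • origin n = origin n) {t t' : ℝ}
    (ht : t ≠ 0) (h1 : k • (flow n t • origin n) = flow n t' • origin n) :
    ∃ δ ρ : ℂ, ‖δ‖ = 1 ∧ (ρ = 1 ∨ ρ = -1) ∧
      ∀ u v, mat k *ᵥ diskVec n u v = δ • diskVec n (ρ * u) v := by
  obtain ⟨δ, hδ⟩ : ∃ δ : ℂ, mat k *ᵥ diskVec n 0 1 = δ • diskVec n 0 1 := by
    have := mat_emb k (origin n)
    rw [h0, emb_origin] at this
    exact ⟨_, this⟩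
  obtain ⟨σ, hσ⟩ : ∃ σ : ℂ, mat k *ᵥ diskVec n (Real.tanh t) 1 =
      σ • diskVec n (Real.tanh t') 1 := by
    have := mat_emb k (flow n t • origin n)
    rw [h1, flow_smul_origin, flow_smul_origin, emb_single, emb_single] at this
    exact ⟨_, this⟩
  have hδ1 : ‖δ‖ = 1 := by
    have h := herm_mat k (diskVec n 0 1) (diskVec n 0 1)
    rw [hδ, herm_smul_left, herm_smul_right, herm_diskVec, ← mul_assoc, Complex.mul_conj'] at h
    have h2 : ‖δ‖ ^ 2 = 1 := by
      have : (‖δ‖ : ℂ) ^ 2 = 1 := by simpa using h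
      exact_mod_cast this
    exact (pow_eq_one_iff_of_nonneg (norm_nonneg _) two_ne_zero).mp h2
  have hδ0 : δ ≠ 0 := norm_ne_zero_iff.mp (by rw [hδ1]; exact one_ne_zero)
  have hτ : (Real.tanh t : ℂ) ≠ 0 := by
    rw [Complex.ofReal_ne_zero]
    rw [Real.tanh_eq_sinh_div_cosh]
    exact div_ne_zero (by simpa using ht) (Real.cosh_pos t).ne'
  set x := mat k *ᵥ diskVec n 1 0 with hx
  have hlin : ∀ u v, mat k *ᵥ diskVec n u v = u • x + v • mat k *ᵥ diskVec n 0 1 := by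
    intro u v
    rw [hx, ← mulVec_smul, ← mulVec_smul, ← mulVec_add, smul_diskVec, smul_diskVec, diskVec_add]
    simp
  -- The images of the last two basis vectors stay orthogonal, and the second image is a multiple of
  -- the negative basis vector.
  have hx0 : x (Sum.inr ()) = 0 := by
    have h := herm_mat k (diskVec n 1 0) (diskVec n 0 1)
    rw [hδ, herm_smul_right, herm_diskVec_right, herm_diskVec, ← hx] at h
    simpa [hδ0] using h
  have hσδ : σ = δ := by
    have h := congrFun hσ (Sum.inr ())
    rw [hlin, hδ] at h
    simpa [hx0, diskVec, eq_comm] using h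
  set ρ : ℂ := Real.tanh t' / Real.tanh t with hρ
  have hxρ : x = δ • diskVec n ρ 0 := by
    have h := hσ
    rw [hlin, hδ, one_smul, hσδ] at h
    have h2 : (Real.tanh t : ℂ) • x = δ • diskVec n (Real.tanh t') 0 := by
      have h3 : δ • diskVec n (Real.tanh t') 1 =
          δ • diskVec n (Real.tanh t') 0 + δ • diskVec n 0 1 := by
        rw [← smul_add, diskVec_add]; simp
      rw [h3] at h
      simpa using h
    rw [← inv_smul_smul₀ hτ x, h2, smul_comm, smul_diskVec, hρ, mul_zero, inv_mul_eq_div]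
  refine ⟨δ, ρ, hδ1, ?_, fun u v => ?_⟩
  · have h := herm_mat k (diskVec n 1 0) (diskVec n 1 0)
    rw [← hx, hxρ, herm_smul_left, herm_smul_right, herm_diskVec, herm_diskVec, ← mul_assoc,
      Complex.mul_conj', hδ1] at h
    have hc : conj ρ = ρ := by rw [hρ, map_div₀, Complex.conj_ofReal, Complex.conj_ofReal]
    rw [hc] at h
    have h2 : ρ * ρ = 1 := by simpa using h
    exact mul_self_eq_one_iff.mp h2
  · rw [hlin, hδ, hxρ, smul_comm, smul_comm v, ← smul_add, smul_diskVec, smul_diskVec, diskVec_add]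
    simp [mul_comm]

/-- A loxodromic element acts on the complex line spanned by its axis, up to a phase, as the
translation `aₛ`; the endpoints of the axis are its fixed points. -/
theorem exists_axis_normal_form {γ g : SU n} {s : ℝ} {X Y : Fin n → ℂ}
    (hX : ∑ j, ‖X j‖ ^ 2 = 1) (hY : ∑ j, ‖Y j‖ ^ 2 = 1) {lam : ℂ} (hlam : 1 < ‖lam‖)
    (hγX : mat γ *ᵥ emb X = (conj lam)⁻¹ • emb X) (hγY : mat γ *ᵥ emb Y = lam • emb Y)
    (hs : 0 < s)
    (hL : (fun z => γ • z) '' ((fun z => g • z) '' stdGeodesic n) =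
      (fun z => g • z) '' stdGeodesic n)
    (h0 : (g * flow n s) • origin n = γ • (g • origin n)) :
    ∃ a b δ : ℂ, emb X = a • mat g *ᵥ diskVec n (-1) 1 ∧ emb Y = b • mat g *ᵥ diskVec n 1 1 ∧
      lam = δ * Real.exp s ∧ ‖δ‖ = 1 ∧
      ∀ u v, mat (g⁻¹ * γ * g) *ᵥ diskVec n u v = δ • mat (flow n s) *ᵥ diskVec n u v := by
  set c := g⁻¹ * γ * g with hc
  have hgc : γ * g = g * c := by rw [hc]; group
  -- `a₋ₛ c` fixes `0` and preserves the standard geodesic. Any nonzero parameter can serve as the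
  -- second test point; `t = 1` is taken.
  obtain ⟨δ, ρ, hδ, hρ, hk⟩ : ∃ δ ρ : ℂ, ‖δ‖ = 1 ∧ (ρ = 1 ∨ ρ = -1) ∧
      ∀ u v, mat ((flow n s)⁻¹ * c) *ᵥ diskVec n u v = δ • diskVec n (ρ * u) v := by
    obtain ⟨t', ht'⟩ : ∃ t' : ℝ, flow n t' • origin n = c • (flow n 1 • origin n) := by
      have : γ • (g • (flow n 1 • origin n)) ∈ (fun z => g • z) '' stdGeodesic n := by
        rw [← hL]
        exact ⟨_, ⟨_, ⟨1, rfl⟩, rfl⟩, rfl⟩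
      obtain ⟨_, ⟨t', rfl⟩, ht'⟩ := this
      refine ⟨t', ?_⟩
      have h := congrArg (fun z => g⁻¹ • z) ht'
      simp only [inv_smul_smul] at h
      simp only [h, hc, mul_smul]
    refine exists_mulVec_diskVec_of_fixes (t := 1) (t' := -s + t') ?_ one_ne_zero ?_
    · have h := congrArg (fun z => g⁻¹ • z) h0
      simp only [mul_smul, inv_smul_smul] at h
      rw [hc, mul_smul, inv_smul_eq_iff, h]
      simp only [mul_smul]
    · rw [flow_add, flow_neg, mul_smul, ← ht', mul_smul]
  have hcv : ∀ u v, mat c *ᵥ diskVec n u v = δ • mat (flow n s) *ᵥ diskVec n (ρ * u) v := by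
    intro u v
    rw [← mulVec_smul, ← hk, ← mat_mul_mulVec, mul_inv_cancel_left]
  have hγg : ∀ v, mat γ *ᵥ (mat g *ᵥ v) = mat g *ᵥ (mat c *ᵥ v) := by
    intro v; rw [← mat_mul_mulVec, hgc, mat_mul_mulVec]
  have hlam0 : lam ≠ 0 := norm_ne_zero_iff.mp (by linarith)
  have hexp : (Real.exp s : ℂ) = Complex.cosh s + Complex.sinh s := by
    rw [Complex.cosh_add_sinh, Complex.ofReal_exp]
  have hexp' : (Real.exp (-s) : ℂ) = Complex.cosh s - Complex.sinh s := by
    rw [Complex.cosh_sub_sinh, Complex.ofReal_exp, Complex.ofReal_neg]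
  have hρ1 : ρ = 1 := by
    refine hρ.resolve_right fun hρ => ?_
    -- If `ρ = -1`, then `c` reverses the axis and fixes the midpoint `tanh (s/2)` of `0` and `tanh
    -- s`, which this vector represents. Its eigenvalue `δ` has modulus 1, and pairing it with the
    -- eigenvector `X` forces `|λ| = 1`.
    set v := diskVec n (Real.exp s - 1) (Real.exp s + 1) with hv
    have hv1 : mat c *ᵥ v = δ • v := by
      rw [hv, hcv, hρ, flow_mulVec_diskVec]
      have e1 : (Complex.cosh s + Complex.sinh s) * (Complex.cosh s - Complex.sinh s) = 1 := by
        linear_combination Complex.cosh_sq_sub_sinh_sq (s : ℂ)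
      congr 2
      · rw [hexp]; linear_combination -e1
      · rw [hexp]; linear_combination e1
    have h1 := herm_mat γ (mat g *ᵥ v) (emb X)
    rw [hγg, hv1, hγX, mulVec_smul, herm_smul_left, herm_smul_right, map_inv₀, Complex.conj_conj,
      ← mul_assoc] at h1
    have hneg : ∑ j : Fin n, ‖(mat g *ᵥ v) (Sum.inl j)‖ ^ 2 < ‖(mat g *ᵥ v) (Sum.inr ())‖ ^ 2 := by
      have h2 := herm_mat g v v
      rw [herm_self, hv, herm_diskVec] at h2
      have h3 : ((Real.exp s : ℂ) - 1) * conj ((Real.exp s : ℂ) - 1) -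
          ((Real.exp s : ℂ) + 1) * conj ((Real.exp s : ℂ) + 1) = ((-4 * Real.exp s : ℝ) : ℂ) := by
        simp only [map_sub, map_add, map_one, Complex.conj_ofReal]
        push_cast; ring
      rw [h3] at h2
      have h4 := Complex.ofReal_injective h2
      have := Real.exp_pos s
      linarith
    have hne := herm_ne_zero_of_neg_of_null hneg (emb_null hX) (emb_ne_zero X)
    have h5 : δ * lam⁻¹ = 1 := mul_right_cancel₀ hne (by rw [h1, one_mul])
    have h6 := congrArg norm h5
    rw [norm_mul, norm_inv, hδ, one_mul, norm_one, inv_eq_one] at h6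
    linarith
  subst hρ1
  simp only [one_mul] at hcv
  have hδ0 : δ ≠ 0 := norm_ne_zero_iff.mp (by rw [hδ]; exact one_ne_zero)
  have hgne : ∀ a : ℂ, mat g *ᵥ diskVec n a 1 ≠ 0 := by
    intro a h
    have := congrArg (fun v => mat g⁻¹ *ᵥ v) h
    simp only [← mat_mul_mulVec, inv_mul_cancel, mat_one_mulVec, mulVec_zero] at this
    simpa [diskVec] using congrFun this (Sum.inr ())
  have hY0 : mat γ *ᵥ (mat g *ᵥ diskVec n 1 1) =
      (δ * Real.exp s) • (mat g *ᵥ diskVec n 1 1) := by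
    rw [hγg, hcv, flow_mulVec_diskVec, mulVec_smul, mul_smul, ← mulVec_smul _ (Real.exp s : ℂ),
      smul_diskVec, hexp]
    congr 3 <;> ring
  have hX0 : mat γ *ᵥ (mat g *ᵥ diskVec n (-1) 1) =
      (δ * Real.exp (-s)) • (mat g *ᵥ diskVec n (-1) 1) := by
    rw [hγg, hcv, flow_mulVec_diskVec, mulVec_smul, mul_smul, ← mulVec_smul _ (Real.exp (-s) : ℂ),
      smul_diskVec, hexp']
    congr 3 <;> ring
  have hnull : ∀ a : ℂ, a = 1 ∨ a = -1 →
      herm (mat g *ᵥ diskVec n a 1) (mat g *ᵥ diskVec n a 1) = 0 := by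
    rintro a (rfl | rfl) <;> simp [herm_mat, herm_diskVec]
  have hes : 1 < Real.exp s := Real.one_lt_exp_iff.mpr hs
  -- Eigenvectors of a unitary map can be non-orthogonal only if one eigenvalue times the conjugate
  -- of the other is 1; here that would give `|λ| eˢ = 1`, with both factors greater than 1.
  obtain ⟨b, hb⟩ := exists_eq_smul_of_null (emb_null hY) (hnull 1 (Or.inl rfl)) (by
    have h := herm_mat γ (emb Y) (mat g *ᵥ diskVec n 1 1)
    rw [hγY, hY0, herm_smul_left, herm_smul_right, ← mul_assoc] at h
    by_contra hne
    have h1 : lam * conj (δ * Real.exp s) = 1 := mul_right_cancel₀ hne (by rw [h, one_mul])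
    have h2 := congrArg norm h1
    rw [norm_mul, RCLike.norm_conj, norm_mul, hδ, one_mul, norm_one, Complex.norm_real,
      Real.norm_of_nonneg (Real.exp_pos s).le] at h2
    nlinarith) (hgne 1)
  obtain ⟨a, ha⟩ := exists_eq_smul_of_null (emb_null hX) (hnull (-1) (Or.inr rfl)) (by
    have h := herm_mat γ (emb X) (mat g *ᵥ diskVec n (-1) 1)
    rw [hγX, hX0, herm_smul_left, herm_smul_right, ← mul_assoc] at h
    by_contra hne
    have h1 : (conj lam)⁻¹ * conj (δ * Real.exp (-s)) = 1 :=
      mul_right_cancel₀ hne (by rw [h, one_mul])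
    have h2 := congrArg norm h1
    rw [norm_mul, RCLike.norm_conj, norm_mul, hδ, one_mul, norm_one, norm_inv, RCLike.norm_conj,
      Complex.norm_real, Real.norm_of_nonneg (Real.exp_pos _).le, Real.exp_neg, ← mul_inv,
      inv_eq_one] at h2
    nlinarith) (hgne (-1))
  refine ⟨a, b, δ, ha, hb, ?_, hδ, hcv⟩
  have h := hγY
  rw [hb, mulVec_smul, hY0, smul_comm, ← hb] at h
  exact (smul_left_injective ℂ (emb_ne_zero Y) h).symm

end Axis

/-! ### Unfolding a sum over cosets into an integral over a larger fundamental domain. -/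

section Unfolding

open scoped Pointwise

theorem exists_mem_mul_out {G : Type*} [Group G] (H : Subgroup G) (g : G) :
    ∃ h ∈ H, (Quotient.out (Quotient.mk (QuotientGroup.rightRel H) g)) = h * g := by
  have h1 : Quotient.mk (QuotientGroup.rightRel H) g =
      Quotient.mk (QuotientGroup.rightRel H)
        (Quotient.out (Quotient.mk (QuotientGroup.rightRel H) g)) := (Quotient.out_eq _).symm
  have h2 := QuotientGroup.rightRel_apply.mp (Quotient.exact h1)
  exact ⟨_, h2, by group⟩

theorem rightRel_out_inj {G : Type*} [Group G] {H : Subgroup G}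
    {c c' : Quotient (QuotientGroup.rightRel H)} {h h' : H}
    (e : (h : G) * c.out = h' * c'.out) : c = c' ∧ h = h' := by
  have hc : c = c' := by
    rw [← Quotient.out_eq c, ← Quotient.out_eq c']
    apply Quotient.sound
    rw [← Quotient.eq_iff_equiv, Quotient.eq]
    refine QuotientGroup.rightRel_apply.mpr ?_
    have : c'.out * c.out⁻¹ = (h' : G)⁻¹ * h := by
      rw [mul_inv_eq_iff_eq_mul, mul_assoc, e, inv_mul_cancel_left]
    rw [this]
    exact H.mul_mem (H.inv_mem h'.2) h.2
  subst hc
  exact ⟨rfl, Subtype.ext (mul_right_cancel e)⟩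

variable {G α : Type*} [Group G] [Countable G] [MulAction G α] [MeasurableSpace α]
  [MeasurableConstSMul G α] {μ : Measure α} [SMulInvariantMeasure G α μ]

/-- A fundamental domain for a subgroup `H` of `G`, from one for `G` and representatives of
`H \ G`. -/
theorem isFundamentalDomain_iUnion_out {D : Set α} (hD : IsFundamentalDomain G D μ)
    (H : Subgroup G) :
    IsFundamentalDomain H (⋃ c : Quotient (QuotientGroup.rightRel H), c.out • D) μ where
  nullMeasurableSet := NullMeasurableSet.iUnion fun c => hD.nullMeasurableSet_smul _
  ae_covers := by
    filter_upwards [hD.ae_covers] with x ⟨g, hg⟩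
    obtain ⟨h, hh, e⟩ := exists_mem_mul_out H g⁻¹
    refine ⟨⟨h, hh⟩, Set.mem_iUnion.mpr ⟨Quotient.mk _ g⁻¹, ?_⟩⟩
    rw [e, Set.mem_smul_set]
    refine ⟨g • x, hg, ?_⟩
    rw [smul_smul, inv_mul_cancel_right]
    rfl
  aedisjoint := by
    intro h h' hne
    change AEDisjoint μ (h • _) (h' • _)
    rw [Set.smul_set_iUnion, Set.smul_set_iUnion, AEDisjoint.iUnion_left_iff]
    intro c
    rw [AEDisjoint.iUnion_right_iff]
    intro c'
    have e : ∀ (k : H) (d : Quotient (QuotientGroup.rightRel H)),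
        k • d.out • D = ((k : G) * d.out) • D := fun k d => by
      rw [mul_smul]; rfl
    rw [e, e]
    exact hD.aedisjoint fun he => hne (rightRel_out_inj he).2

/-- The translates of `D` by coset representatives tile a fundamental domain of `H`, and any two
such domains give the same integral. Applied to `‖u‖ₑ`, this is the Tonelli estimate behind the
three results that follow. -/
theorem lintegral_sum_out_eq {D D₀ : Set α} (hD : IsFundamentalDomain G D μ) (H : Subgroup G)
    (hD₀ : IsFundamentalDomain H D₀ μ) {u : α → ENNReal} (hinv : ∀ (h : H) x, u (h • x) = u x) :
    ∑' c : Quotient (QuotientGroup.rightRel H), ∫⁻ x in D, u (c.out • x) ∂μ =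
      ∫⁻ x in D₀, u x ∂μ := by
  rw [hD₀.setLIntegral_eq (isFundamentalDomain_iUnion_out hD H) u hinv,
    lintegral_iUnion₀ (fun c => hD.nullMeasurableSet_smul _)]
  · refine tsum_congr fun c => ?_
    rw [← Set.image_smul]
    exact ((measurePreserving_smul c.out μ).setLIntegral_comp_emb
      (measurableEmbedding_const_smul c.out) u D)
  · intro c c' hne
    refine hD.aedisjoint fun he => hne ?_
    exact (rightRel_out_inj (H := H) (h := 1) (h' := 1) (by rw [he])).1

variable {D D₀ : Set α} {H : Subgroup G} {u : α → ℂ}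

theorem ae_summable_out (hD : IsFundamentalDomain G D μ) (hD₀ : IsFundamentalDomain H D₀ μ)
    (hinv : ∀ (h : H) x, u (h • x) = u x) (hu : IntegrableOn u D₀ μ) (hm : Measurable u) :
    ∀ᵐ x ∂μ.restrict D,
      Summable fun c : Quotient (QuotientGroup.rightRel H) => ‖u (c.out • x)‖ := by
  have h := lintegral_sum_out_eq hD H hD₀ (u := fun x => ‖u x‖ₑ) fun h x => by rw [hinv]
  have hmc : ∀ c : Quotient (QuotientGroup.rightRel H),
      Measurable fun x => ‖u (c.out • x)‖ₑ := fun c =>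
    (hm.comp (measurable_const_smul _)).enorm
  rw [← lintegral_tsum fun c => (hmc c).aemeasurable] at h
  have h2 := ae_lt_top (Measurable.tsum hmc) (h.trans_ne hu.2.ne)
  filter_upwards [h2] with x hx
  exact tsum_enorm_ne_top_iff_summable_norm.1 hx.ne

theorem integrableOn_tsum_out (hD : IsFundamentalDomain G D μ) (hD₀ : IsFundamentalDomain H D₀ μ)
    (hinv : ∀ (h : H) x, u (h • x) = u x) (hu : IntegrableOn u D₀ μ) (hm : Measurable u) :
    IntegrableOn (fun x => ∑' c : Quotient (QuotientGroup.rightRel H), u (c.out • x)) D μ := by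
  have h := lintegral_sum_out_eq hD H hD₀ (u := fun x => ‖u x‖ₑ) fun h x => by rw [hinv]
  have hmc : ∀ c : Quotient (QuotientGroup.rightRel H),
      Measurable fun x => u (c.out • x) := fun c => hm.comp (measurable_const_smul _)
  rw [← lintegral_tsum fun c => (hmc c).enorm.aemeasurable] at h
  refine ⟨?_, ?_⟩
  · refine aestronglyMeasurable_of_tendsto_ae (atTop : Filter (Finset _))
      (f := fun s x => ∑ c ∈ s, u (Quotient.out c • x))
      (fun s => (Finset.measurable_fun_sum s fun c _ => hmc c).aestronglyMeasurable) ?_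
    filter_upwards [ae_summable_out hD hD₀ hinv hu hm] with x hx
    exact hx.of_norm.hasSum
  · refine lt_of_le_of_lt (lintegral_mono fun x => ?_) (h.trans_lt hu.2)
    exact enorm_tsum_le_tsum_enorm

theorem setIntegral_tsum_out (hD : IsFundamentalDomain G D μ) (hD₀ : IsFundamentalDomain H D₀ μ)
    (hinv : ∀ (h : H) x, u (h • x) = u x) (hu : IntegrableOn u D₀ μ) (hm : Measurable u) :
    ∫ x in D, ∑' c : Quotient (QuotientGroup.rightRel H), u (c.out • x) ∂μ =
      ∫ x in D₀, u x ∂μ := by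
  have h := lintegral_sum_out_eq hD H hD₀ (u := fun x => ‖u x‖ₑ) fun h x => by rw [hinv]
  have hE := isFundamentalDomain_iUnion_out hD H
  rw [integral_tsum (f := fun (c : Quotient (QuotientGroup.rightRel H)) x => u (c.out • x))
    (fun c => (hm.comp (measurable_const_smul _)).aestronglyMeasurable)
    (h.trans_ne hu.2.ne), hD₀.setIntegral_eq hE hinv, integral_iUnion_ae]
  · refine tsum_congr fun c => ?_
    rw [← Set.image_smul]
    exact ((measurePreserving_smul c.out μ).setIntegral_image_emb
      (measurableEmbedding_const_smul c.out) u D).symm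
  · exact fun c => hD.nullMeasurableSet_smul _
  · intro c c' hne
    refine hD.aedisjoint fun he => hne ?_
    exact (rightRel_out_inj (H := H) (h := 1) (h' := 1) (by rw [he])).1
  · exact (hD₀.integrableOn_iff hE hinv).mp hu

end Unfolding

/-! ### Beta integrals over balls in complex space. -/

section BallIntegral

theorem integral_pi_snoc {N : ℕ} {E : Type*} [NormedAddCommGroup E] [NormedSpace ℝ E]
    {f : (Fin (N + 1) → ℂ) → E} (hf : Integrable f) :
    ∫ z, f z = ∫ w : ℂ, ∫ z : Fin N → ℂ, f (Fin.snoc z w) := by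
  have hmp := volume_preserving_piFinSuccAbove (fun _ : Fin (N + 1) => ℂ) (Fin.last N)
  set e := MeasurableEquiv.piFinSuccAbove (fun _ : Fin (N + 1) => ℂ) (Fin.last N)
  have hs : ∀ p : ℂ × (Fin N → ℂ), e.symm p = Fin.snoc p.2 p.1 := by
    intro p
    exact Fin.insertNth_last (α := fun _ => ℂ) p.1 p.2
  have h1 : ∫ z, f z = ∫ p, f (e.symm p) :=
    ((hmp.symm e).integral_comp' f).symm
  have h2 : Integrable fun p => f (e.symm p) :=
    (hmp.symm e).integrable_comp_of_integrable hf
  rw [h1]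
  simp only [hs] at h2 ⊢
  exact integral_prod _ h2

theorem integrable_max_sub_sum_pow (N : ℕ) {p : ℕ} (hp : p ≠ 0) (R : ℝ) :
    Integrable fun z : Fin N → ℂ => max (R - ∑ j, ‖z j‖ ^ 2) 0 ^ p := by
  refine Continuous.integrable_of_hasCompactSupport (by fun_prop) ?_
  refine HasCompactSupport.intro (isCompact_closedBall (0 : Fin N → ℂ) √R) fun z hz => ?_
  have : R - ∑ j, ‖z j‖ ^ 2 ≤ 0 := by
    by_contra h
    apply hz
    rw [mem_closedBall_zero_iff, pi_norm_le_iff_of_nonneg (Real.sqrt_nonneg _)]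
    intro i
    apply Real.le_sqrt_of_sq_le
    have : ‖z i‖ ^ 2 ≤ ∑ j, ‖z j‖ ^ 2 := Finset.single_le_sum (f := fun j => ‖z j‖ ^ 2)
      (fun j _ => by positivity) (Finset.mem_univ i)
    linarith
  rw [max_eq_right this, zero_pow hp]

theorem integral_max_sub_sq_pow (q : ℕ) (hq : q ≠ 0) (R : ℝ) :
    ∫ w : ℂ, max (R - ‖w‖ ^ 2) 0 ^ q = Real.pi / (q + 1) * max R 0 ^ (q + 1) := by
  rw [integral_fun_norm_addHaar volume fun y : ℝ => max (R - y ^ 2) 0 ^ q]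
  have hv : (volume : Measure ℂ).real (Metric.ball 0 1) = Real.pi := by
    simp [Measure.real, Complex.volume_ball]
  rw [hv, Complex.finrank_real_complex]
  have hint : ∫ y in Set.Ioi (0 : ℝ), y ^ (2 - 1) • max (R - y ^ 2) 0 ^ q =
      max R 0 ^ (q + 1) / (2 * (q + 1)) := by
    rcases le_or_gt R 0 with hR | hR
    · rw [max_eq_right hR, setIntegral_eq_zero_of_forall_eq_zero]
      · simp
      · intro y _
        rw [max_eq_right (by nlinarith [sq_nonneg y]), zero_pow hq, smul_zero]
    · rw [max_eq_left hR.le, setIntegral_eq_of_subset_of_forall_sdiff_eq_zero (s := Set.Ioc 0 √R)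
        measurableSet_Ioi Set.Ioc_subset_Ioi_self, ← intervalIntegral.integral_of_le
        (Real.sqrt_nonneg _)]
      · have hcong : ∫ y in (0 : ℝ)..√R, y ^ (2 - 1) • max (R - y ^ 2) 0 ^ q =
            ∫ y in (0 : ℝ)..√R, y * (R - y ^ 2) ^ q := by
          refine intervalIntegral.integral_congr fun y hy => ?_
          rw [Set.uIcc_of_le (Real.sqrt_nonneg _)] at hy
          have : y ^ 2 ≤ R := (Real.le_sqrt hy.1 hR.le).mp hy.2
          simp [max_eq_left (sub_nonneg.mpr this)]
        have hderiv : ∀ y : ℝ, HasDerivAt (fun y => -(R - y ^ 2) ^ (q + 1) / (2 * (q + 1)))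
            (y * (R - y ^ 2) ^ q) y := by
          intro y
          have h := ((((hasDerivAt_id y).pow 2).const_sub R).pow (q + 1)).neg.div_const
            (2 * ((q : ℝ) + 1))
          refine HasDerivAt.congr_deriv h ?_
          simp only [Pi.pow_apply, id]
          push_cast
          have : (q : ℝ) + 1 ≠ 0 := by positivity
          simp
          field_simp
        rw [hcong, intervalIntegral.integral_eq_sub_of_hasDerivAt (fun y _ => hderiv y)
          (Continuous.intervalIntegrable (by fun_prop) _ _), Real.sq_sqrt hR.le]
        simp [neg_div]
      · rintro y ⟨hy1, hy2⟩
        have : √R < y := by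
          by_contra h
          exact hy2 ⟨hy1, not_lt.mp h⟩
        have := (Real.sqrt_lt' hy1).mp this
        rw [max_eq_right (by linarith), zero_pow hq, smul_zero]
  rw [hint]
  simp only [nsmul_eq_mul, smul_eq_mul]
  push_cast
  field_simp

/-- Positive parts with a free `R` make the induction close: fixing one coordinate `w` replaces `R`
by `R - |w|²`, which may be negative. The condition `p ≠ 0` excludes `0 ^ 0 = 1` outside the ball.
-/
theorem integral_max_sub_sum_pow (N : ℕ) {p : ℕ} (hp : p ≠ 0) (R : ℝ) :
    ∫ z : Fin N → ℂ, max (R - ∑ j, ‖z j‖ ^ 2) 0 ^ p =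
      Real.pi ^ N * (p ! / (p + N)!) * max R 0 ^ (p + N) := by
  induction N generalizing R with
  | zero =>
    rw [integral_unique]
    simp [Nat.factorial_ne_zero, Measure.real, volume_pi]
  | succ N ih =>
    rw [integral_pi_snoc (integrable_max_sub_sum_pow _ hp R)]
    have h : ∀ w : ℂ, ∫ z : Fin N → ℂ,
        max (R - ∑ j, ‖(Fin.snoc z w : Fin (N + 1) → ℂ) j‖ ^ 2) 0 ^ p =
        Real.pi ^ N * (p ! / (p + N)!) * max (R - ‖w‖ ^ 2) 0 ^ (p + N) := by
      intro w
      rw [← ih]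
      refine integral_congr_ae (ae_of_all _ fun z => ?_)
      simp only [Fin.sum_univ_castSucc, Fin.snoc_castSucc, Fin.snoc_last]
      congr 2
      ring
    simp only [h]
    rw [integral_const_mul, integral_max_sub_sq_pow _ (by omega)]
    rw [← add_assoc, Nat.factorial_succ (p + N)]
    push_cast
    have := Nat.factorial_ne_zero (p + N)
    field_simp
    ring

end BallIntegral

/-! ### Reduction from the ball to the disc by the mean value property. -/

section Averaging

variable {n : ℕ} [NeZero n]

/-- The open unit ball of `ℂⁿ`, as a set. -/
def unitBall (n : ℕ) : Set (Fin n → ℂ) := {z | ∑ j, ‖z j‖ ^ 2 < 1}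

theorem isOpen_unitBall (n : ℕ) : IsOpen (unitBall n) :=
  isOpen_lt (by fun_prop) continuous_const

theorem unitBall_subset_closedBall (n : ℕ) :
    unitBall n ⊆ Metric.closedBall (0 : Fin n → ℂ) 1 := by
  intro z hz
  rw [mem_closedBall_zero_iff, pi_norm_le_iff_of_nonneg zero_le_one]
  intro i
  have h : ‖z i‖ ^ 2 ≤ ∑ j, ‖z j‖ ^ 2 := Finset.single_le_sum (f := fun j => ‖z j‖ ^ 2)
    (fun j _ => by positivity) (Finset.mem_univ i)
  exact (sq_le_one_iff₀ (norm_nonneg _)).mp (h.trans (le_of_lt hz))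

theorem volume_unitBall_lt_top (n : ℕ) : volume (unitBall n) < ⊤ :=
  (measure_mono (unitBall_subset_closedBall n)).trans_lt measure_closedBall_lt_top

theorem measurable_indicator_of_continuousOn {α : Type*} [TopologicalSpace α] [MeasurableSpace α]
    [BorelSpace α] {s : Set α} (hs : IsOpen s) {F : α → ℂ} (hF : ContinuousOn F s) :
    Measurable (s.indicator F) := by
  classical
  rw [← Set.piecewise_eq_indicator]
  exact hF.measurable_piecewise continuousOn_const hs.measurableSet

/-- Multiplication of all but the last coordinate by `ζ`. -/
def rotateHead (ζ : ℂ) (z : Fin n → ℂ) : Fin n → ℂ :=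
  fun i => if i = lastIdx n then z i else ζ * z i

theorem rotateHead_last (ζ : ℂ) (z : Fin n → ℂ) : rotateHead ζ z (lastIdx n) = z (lastIdx n) := by
  simp [rotateHead]

theorem rotateHead_zero (z : Fin n → ℂ) :
    rotateHead 0 z = Pi.single (lastIdx n) (z (lastIdx n)) := by
  funext i
  by_cases h : i = lastIdx n
  · subst h; simp [rotateHead]
  · simp [rotateHead, h]

theorem sum_norm_single (w : ℂ) :
    ∑ j, ‖(Pi.single (lastIdx n) w : Fin n → ℂ) j‖ ^ 2 = ‖w‖ ^ 2 := by
  rw [Finset.sum_eq_single (lastIdx n)]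
  · simp
  · intro j _ hj; simp [hj]
  · simp

theorem norm_last_sq_le (z : Fin n → ℂ) : ‖z (lastIdx n)‖ ^ 2 ≤ ∑ j, ‖z j‖ ^ 2 :=
  Finset.single_le_sum (f := fun j => ‖z j‖ ^ 2) (fun j _ => by positivity) (Finset.mem_univ _)

theorem sum_norm_rotateHead {ζ : ℂ} (hζ : ‖ζ‖ = 1) (z : Fin n → ℂ) :
    ∑ j, ‖rotateHead ζ z j‖ ^ 2 = ∑ j, ‖z j‖ ^ 2 := by
  refine Finset.sum_congr rfl fun j _ => ?_
  unfold rotateHead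
  split_ifs <;> simp [hζ]

theorem sum_norm_rotateHead_le {ζ : ℂ} (hζ : ‖ζ‖ ≤ 1) (z : Fin n → ℂ) :
    ∑ j, ‖rotateHead ζ z j‖ ^ 2 ≤ ∑ j, ‖z j‖ ^ 2 := by
  refine Finset.sum_le_sum fun j _ => ?_
  unfold rotateHead
  split_ifs
  · rfl
  · rw [norm_mul]
    gcongr
    exact mul_le_of_le_one_left (norm_nonneg _) hζ

theorem measurePreserving_rotateHead {ζ : ℂ} (hζ : ‖ζ‖ = 1) :
    MeasurePreserving (rotateHead (n := n) ζ) := by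
  have h : ∀ i : Fin n, MeasurePreserving (fun w : ℂ => if i = lastIdx n then w else ζ * w) := by
    intro i
    by_cases hi : i = lastIdx n
    · simp only [hi, if_true]; exact MeasurePreserving.id _
    · simp only [hi, if_false]
      exact (rotation ⟨ζ, mem_sphere_zero_iff_norm.mpr hζ⟩).measurePreserving
  exact volume_preserving_pi h

/-- The function `ζ ↦ F(ζ z', zₙ)` is holomorphic near the closed unit disc, so its circle average
is its value at `ζ = 0`. -/
theorem circleAverage_comp_rotateHead {F : (Fin n → ℂ) → ℂ}
    (hF : DifferentiableOn ℂ F (unitBall n)) {z : Fin n → ℂ} (hz : z ∈ unitBall n) :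
    Real.circleAverage (fun ζ => F (rotateHead ζ z)) 0 1 =
      F (Pi.single (lastIdx n) (z (lastIdx n))) := by
  rw [← rotateHead_zero]
  refine DiffContOnCl.circleAverage (f := fun ζ => F (rotateHead ζ z)) ?_
  refine DifferentiableOn.diffContOnCl (hF.comp (t := unitBall n) ?_ ?_)
  · refine Differentiable.differentiableOn ?_
    refine differentiable_pi.mpr fun i => ?_
    unfold rotateHead
    split_ifs <;> fun_prop
  · intro ζ hζ
    rw [abs_one, closure_ball _ one_ne_zero, mem_closedBall_zero_iff] at hζ
    exact (sum_norm_rotateHead_le hζ z).trans_lt hz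

/-- Rotating the first `n - 1` coordinates preserves the ball, Lebesgue measure and the weight.
Averaging the integral over all rotations and exchanging the order puts the mean value of `F` under
the integral. -/
theorem setIntegral_unitBall_average {F : (Fin n → ℂ) → ℂ}
    (hF : DifferentiableOn ℂ F (unitBall n)) {u : ℂ → ℂ} (hu : Measurable u) (p : ℕ) {K : ℝ}
    (hK : ∀ z ∈ unitBall n,
      ‖F z * (u (z (lastIdx n)) * ((1 - ∑ j, ‖z j‖ ^ 2 : ℝ) : ℂ) ^ p)‖ ≤ K) :
    ∫ z in unitBall n, F z * (u (z (lastIdx n)) * ((1 - ∑ j, ‖z j‖ ^ 2 : ℝ) : ℂ) ^ p) =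
    ∫ z in unitBall n, F (Pi.single (lastIdx n) (z (lastIdx n))) *
      (u (z (lastIdx n)) * ((1 - ∑ j, ‖z j‖ ^ 2 : ℝ) : ℂ) ^ p) := by
  have hB := (isOpen_unitBall n).measurableSet
  set W : (Fin n → ℂ) → ℂ := fun z => u (z (lastIdx n)) * ((1 - ∑ j, ‖z j‖ ^ 2 : ℝ) : ℂ) ^ p with hW
  have hWm : Measurable W := by
    refine (hu.comp (measurable_pi_apply _)).mul ?_
    exact Continuous.measurable (by fun_prop)
  have hWr : ∀ ζ : ℂ, ‖ζ‖ = 1 → ∀ z, W (rotateHead ζ z) = W z := by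
    intro ζ hζ z
    simp only [hW, rotateHead_last, sum_norm_rotateHead hζ]
  -- `F` is controlled only inside the ball; the cut-off makes the integrand measurable and bounded
  -- everywhere, as Fubini requires.
  set G : (Fin n → ℂ) → ℂ := fun z => (unitBall n).indicator F z * W z with hG
  have hGm : Measurable G :=
    (measurable_indicator_of_continuousOn (isOpen_unitBall n) hF.continuousOn).mul hWm
  have hG0 : ∀ z ∉ unitBall n, G z = 0 := fun z hz => by simp [hG, hz]
  have hGF : ∀ z ∈ unitBall n, G z = F z * W z := fun z hz => by simp [hG, hz]
  have hGK : ∀ z, ‖G z‖ ≤ max K 0 := by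
    intro z
    by_cases hz : z ∈ unitBall n
    · rw [hGF z hz]; exact (hK z hz).trans (le_max_left _ _)
    · rw [hG0 z hz, norm_zero]; exact le_max_right _ _
  have hmem : ∀ ζ : ℂ, ‖ζ‖ = 1 → ∀ z : Fin n → ℂ, rotateHead ζ z ∈ unitBall n ↔ z ∈ unitBall n := by
    intro ζ hζ z
    simp only [unitBall, Set.mem_ofPred_eq, sum_norm_rotateHead hζ]
  have hc : ∀ θ : ℝ, ‖circleMap 0 1 θ‖ = 1 := fun θ => by simp
  have hrot : ∀ θ : ℝ, ∫ z in unitBall n, G (rotateHead (circleMap 0 1 θ) z) =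
      ∫ z in unitBall n, F z * W z := by
    intro θ
    rw [setIntegral_eq_integral_of_forall_compl_eq_zero fun z hz => hG0 _ (by rwa [hmem _ (hc θ)])]
    have hmp := measurePreserving_rotateHead (n := n) (hc θ)
    calc ∫ z, G (rotateHead (circleMap 0 1 θ) z) = ∫ z, G z := by
          conv_rhs => rw [← hmp.map_eq]
          exact (integral_map hmp.measurable.aemeasurable hGm.aestronglyMeasurable).symm
      _ = ∫ z in unitBall n, G z :=
          (setIntegral_eq_integral_of_forall_compl_eq_zero fun z hz => hG0 z hz).symm
      _ = _ := setIntegral_congr_fun hB hGF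
  have hswap : ∫ z in unitBall n, ∫ θ in (0 : ℝ)..2 * Real.pi,
        G (rotateHead (circleMap 0 1 θ) z) =
      ∫ θ in (0 : ℝ)..2 * Real.pi, ∫ z in unitBall n, G (rotateHead (circleMap 0 1 θ) z) := by
    simp only [intervalIntegral.integral_of_le Real.two_pi_pos.le]
    refine integral_integral_swap (f := fun z θ => G (rotateHead (circleMap 0 1 θ) z)) ?_
    have : IsFiniteMeasure (volume.restrict (unitBall n)) :=
      ⟨by simpa using volume_unitBall_lt_top n⟩
    refine Integrable.of_bound (C := max K 0) ?_ (ae_of_all _ fun z => hGK _)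
    refine (hGm.comp (Continuous.measurable ?_)).aestronglyMeasurable
    refine continuous_pi fun i => ?_
    unfold rotateHead
    split_ifs
    · fun_prop
    · have := continuous_circleMap 0 1
      fun_prop
  have hinner : ∀ z ∈ unitBall n, ∫ θ in (0 : ℝ)..2 * Real.pi,
      G (rotateHead (circleMap 0 1 θ) z) =
        (2 * Real.pi : ℝ) • (F (Pi.single (lastIdx n) (z (lastIdx n))) * W z) := by
    intro z hz
    rw [← circleAverage_comp_rotateHead hF hz, Real.circleAverage_def, smul_mul_assoc,
      smul_inv_smul₀ Real.two_pi_pos.ne', ← intervalIntegral.integral_mul_const]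
    refine intervalIntegral.integral_congr fun θ _ => ?_
    simp only [hGF _ ((hmem _ (hc θ) z).mpr hz), hWr _ (hc θ)]
  rw [setIntegral_congr_fun hB hinner] at hswap
  simp only [hrot] at hswap
  rw [integral_smul, intervalIntegral.integral_const, sub_zero] at hswap
  exact (smul_right_injective ℂ Real.two_pi_pos.ne' hswap).symm

theorem single_mem_unitBall {w : ℂ} :
    (Pi.single (lastIdx n) w : Fin n → ℂ) ∈ unitBall n ↔ ‖w‖ < 1 := by
  rw [unitBall, Set.mem_ofPred_eq, sum_norm_single, sq_lt_one_iff₀ (norm_nonneg _)]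

/-- A weighted integral of a holomorphic function over the ball, with a weight depending on the
last coordinate and the norm only, reduces to an integral over the disc. -/
theorem setIntegral_unitBall_eq_disc {F : (Fin n → ℂ) → ℂ}
    (hF : DifferentiableOn ℂ F (unitBall n)) {u : ℂ → ℂ} (hu : Measurable u) {p : ℕ} (hp : p ≠ 0)
    {K : ℝ} (hK : ∀ z ∈ unitBall n,
      ‖F z * (u (z (lastIdx n)) * ((1 - ∑ j, ‖z j‖ ^ 2 : ℝ) : ℂ) ^ p)‖ ≤ K) :
    ∫ z in unitBall n, F z * (u (z (lastIdx n)) * ((1 - ∑ j, ‖z j‖ ^ 2 : ℝ) : ℂ) ^ p) =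
    ((Real.pi ^ (n - 1) * (p ! / (p + (n - 1))!) : ℝ) : ℂ) * ∫ w in Metric.ball (0 : ℂ) 1,
      F (Pi.single (lastIdx n) w) * (u w * ((1 - ‖w‖ ^ 2 : ℝ) : ℂ) ^ (p + (n - 1))) := by
  rw [setIntegral_unitBall_average hF hu p hK]
  obtain ⟨N, rfl⟩ : ∃ N, n = N + 1 := ⟨n - 1, (Nat.succ_pred_eq_of_ne_zero (NeZero.ne n)).symm⟩
  have hB := (isOpen_unitBall (N + 1)).measurableSet
  rw [Nat.add_sub_cancel]
  set l := lastIdx (N + 1) with hl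
  have hlast : l = Fin.last N := rfl
  set V : ℂ → ℂ := (Metric.ball (0 : ℂ) 1).indicator fun w => F (Pi.single l w) with hV
  have hVm : Measurable V := by
    refine measurable_indicator_of_continuousOn Metric.isOpen_ball (hF.continuousOn.comp
      (t := unitBall (N + 1)) ?_ ?_)
    · exact (continuous_single (A := fun _ : Fin (N + 1) => ℂ) l).continuousOn
    · intro w hw
      exact single_mem_unitBall.mpr (mem_ball_zero_iff.mp hw)
  set P : (Fin (N + 1) → ℂ) → ℂ := fun z =>
    V (z l) * u (z l) * ((max (1 - ∑ j, ‖z j‖ ^ 2) 0 ^ p : ℝ) : ℂ) with hP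
  have hlt : ∀ z ∈ unitBall (N + 1), ‖z l‖ < 1 := fun z hz =>
    (sq_lt_one_iff₀ (norm_nonneg _)).mp ((norm_last_sq_le z).trans_lt hz)
  have hPin : ∀ z ∈ unitBall (N + 1), F (Pi.single l (z l)) *
      (u (z l) * ((1 - ∑ j, ‖z j‖ ^ 2 : ℝ) : ℂ) ^ p) = P z := by
    intro z hz
    have h1 := hlt z hz
    have h2 : 0 ≤ 1 - ∑ j, ‖z j‖ ^ 2 := sub_nonneg.mpr (le_of_lt hz)
    simp only [hP, hV]
    rw [Set.indicator_of_mem (mem_ball_zero_iff.mpr h1), max_eq_left h2]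
    push_cast
    ring
  have hPout : ∀ z ∉ unitBall (N + 1), P z = 0 := by
    intro z hz
    have h2 : 1 - ∑ j, ‖z j‖ ^ 2 ≤ 0 := sub_nonpos.mpr (not_lt.mp hz)
    simp [hP, max_eq_right h2, hp]
  have hPm : Measurable P := by
    refine ((hVm.comp (measurable_pi_apply _)).mul (hu.comp (measurable_pi_apply _))).mul ?_
    exact Continuous.measurable (by fun_prop)
  have hPint : Integrable P := by
    have : IsFiniteMeasure (volume.restrict (unitBall (N + 1))) :=
      ⟨by simpa using volume_unitBall_lt_top (N + 1)⟩
    have h : IntegrableOn P (unitBall (N + 1)) := by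
      refine Integrable.of_bound (C := K) hPm.aestronglyMeasurable ?_
      filter_upwards [ae_restrict_mem hB] with z hz
      rw [← hPin z hz]
      -- The bound is used at the projection of `z` to the disc, where `1 - |zₙ|²` dominates `1 -
      -- |z|²`.
      have h1 := hK _ (single_mem_unitBall.mpr (hlt z hz))
      rw [sum_norm_single] at h1
      refine le_trans ?_ h1
      simp only [Pi.single_eq_same, norm_mul, norm_pow, Complex.norm_real, ← hl]
      have h2 : 0 ≤ 1 - ∑ j, ‖z j‖ ^ 2 := sub_nonneg.mpr (le_of_lt hz)
      have h3 := norm_last_sq_le z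
      rw [Real.norm_of_nonneg h2, Real.norm_of_nonneg (h2.trans (sub_le_sub_left h3 1))]
      gcongr
    rw [← integrableOn_univ]
    exact ((integrableOn_iff_integrable_of_support_subset
      (Function.support_subset_iff'.mpr hPout)).mp h).integrableOn
  rw [setIntegral_congr_fun hB hPin, setIntegral_eq_integral_of_forall_compl_eq_zero hPout,
    integral_pi_snoc hPint, ← integral_const_mul]
  have hinner : ∀ w : ℂ, ∫ z : Fin N → ℂ, P (Fin.snoc z w) = (Metric.ball (0 : ℂ) 1).indicator
      (fun w => ((Real.pi ^ N * (p ! / (p + N)!) : ℝ) : ℂ) *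
        (F (Pi.single l w) * (u w * ((1 - ‖w‖ ^ 2 : ℝ) : ℂ) ^ (p + N)))) w := by
    intro w
    have h1 : ∀ z : Fin N → ℂ, P (Fin.snoc z w) =
        V w * u w * ((max ((1 - ‖w‖ ^ 2) - ∑ j, ‖z j‖ ^ 2) 0 ^ p : ℝ) : ℂ) := by
      intro z
      simp only [hP, hlast, Fin.sum_univ_castSucc, Fin.snoc_castSucc, Fin.snoc_last]
      congr 4
      ring
    simp only [h1]
    rw [integral_const_mul, integral_complex_ofReal, integral_max_sub_sum_pow N hp]
    by_cases hw : w ∈ Metric.ball (0 : ℂ) 1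
    · have h2 : 0 ≤ 1 - ‖w‖ ^ 2 := sub_nonneg.mpr
        ((sq_lt_one_iff₀ (norm_nonneg _)).mpr (mem_ball_zero_iff.mp hw)).le
      rw [Set.indicator_of_mem hw, max_eq_left h2, hV, Set.indicator_of_mem hw]
      push_cast
      ring
    · rw [hV, Set.indicator_of_notMem hw, Set.indicator_of_notMem hw]
      ring
  simp only [hinner]
  rw [integral_indicator Metric.isOpen_ball.measurableSet]

end Averaging

/-! ### The integral over a sector of the disc, in the coordinate `w = tanh ζ`. -/

section DiscIntegral

theorem integral_cos_two_mul_pow (k : ℕ) :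
    ∫ θ in -(Real.pi / 4)..Real.pi / 4, Real.cos (2 * θ) ^ (2 * k) =
      Real.pi / 2 * ((2 * k)! / ((k ! : ℝ) ^ 2 * 4 ^ k)) := by
  have h1 : ∀ θ : ℝ, Real.cos (2 * θ) = Real.sin (2 * θ + Real.pi / 2) := fun θ => by
    rw [Real.sin_add_pi_div_two]
  simp only [h1]
  rw [intervalIntegral.integral_comp_mul_add (fun x => Real.sin x ^ (2 * k)) two_ne_zero]
  have e1 : 2 * -(Real.pi / 4) + Real.pi / 2 = 0 := by ring
  have e2 : 2 * (Real.pi / 4) + Real.pi / 2 = Real.pi := by ring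
  rw [e1, e2, integral_sin_pow_even, smul_eq_mul]
  have h2 : ∏ i ∈ Finset.range k, (2 * (i : ℝ) + 1) / (2 * i + 2) =
      (2 * k)! / ((k ! : ℝ) ^ 2 * 4 ^ k) := by
    induction k with
    | zero => simp
    | succ k ih =>
      rw [Finset.prod_range_succ, ih, show 2 * (k + 1) = 2 * k + 1 + 1 by ring, Nat.factorial_succ,
        Nat.factorial_succ, Nat.factorial_succ, pow_succ 4]
      have := Nat.factorial_ne_zero k
      push_cast
      field_simp
      ring
  rw [h2]
  ring

theorem cosh_ne_zero_of_abs_im_lt {ζ : ℂ} (h : |ζ.im| < Real.pi / 4) : Complex.cosh ζ ≠ 0 := by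
  have hpi := Real.pi_pos
  obtain ⟨h1, h2⟩ := abs_lt.mp h
  rw [← Complex.cos_mul_I]
  intro h0
  obtain ⟨k, hk⟩ := Complex.cos_eq_zero_iff.mp h0
  have h3 := congrArg Complex.re hk
  have h4 : -ζ.im = (2 * k + 1) * Real.pi / 2 := by
    have : ((2 * (k : ℂ) + 1) * Real.pi / 2) = (((2 * k + 1) * Real.pi / 2 : ℝ) : ℂ) := by
      push_cast; ring
    rw [this, Complex.ofReal_re] at h3
    simpa using h3
  have h5 : |-ζ.im| < Real.pi / 2 := by rw [abs_neg]; linarith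
  rw [h4, abs_lt] at h5
  have h6 : (2 * (k : ℝ) + 1) < 1 := by nlinarith
  have h7 : (-1 : ℝ) < 2 * (k : ℝ) + 1 := by nlinarith
  have h8 : 2 * k + 1 < 1 := by exact_mod_cast h6
  have h9 : -1 < 2 * k + 1 := by exact_mod_cast h7
  omega

/-- The addition formula gives `|cosh ζ|² - |sinh ζ|² = cosh (ζ - ζ̄) = cos (2 Im ζ)`. -/
theorem one_sub_norm_tanh_sq {ζ : ℂ} (h : |ζ.im| < Real.pi / 4) :
    ((1 - ‖Complex.tanh ζ‖ ^ 2 : ℝ) : ℂ) =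
      Real.cos (2 * ζ.im) / (Complex.cosh ζ * conj (Complex.cosh ζ)) := by
  have hc := cosh_ne_zero_of_abs_im_lt h
  have hc' : conj (Complex.cosh ζ) ≠ 0 := (map_ne_zero _).mpr hc
  have key : Complex.cosh ζ * conj (Complex.cosh ζ) - Complex.sinh ζ * conj (Complex.sinh ζ) =
      Real.cos (2 * ζ.im) := by
    rw [← Complex.cosh_conj, ← Complex.sinh_conj, ← Complex.cosh_sub, Complex.sub_conj,
      Complex.cosh_mul_I, Complex.ofReal_cos]
  push_cast
  rw [← Complex.mul_conj', Complex.tanh_eq_sinh_div_cosh, map_div₀, ← Complex.ofReal_ofNat,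
    ← Complex.ofReal_mul, ← Complex.ofReal_cos, ← key]
  field_simp

theorem norm_tanh_lt_one {ζ : ℂ} (h : |ζ.im| < Real.pi / 4) : ‖Complex.tanh ζ‖ < 1 := by
  have hc := cosh_ne_zero_of_abs_im_lt h
  have h1 := one_sub_norm_tanh_sq h
  rw [Complex.mul_conj', ← Complex.ofReal_pow, ← Complex.ofReal_div] at h1
  have h2 := Complex.ofReal_injective h1
  have h3 : 0 < Real.cos (2 * ζ.im) := by
    apply Real.cos_pos_of_mem_Ioo
    obtain ⟨h1, h2⟩ := abs_lt.mp h
    constructor <;> linarith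
  have h4 : 0 < 1 - ‖Complex.tanh ζ‖ ^ 2 := by
    rw [h2]
    have := norm_pos_iff.mpr hc
    positivity
  exact (sq_lt_one_iff₀ (norm_nonneg _)).mp (by linarith)

theorem one_add_tanh {ζ : ℂ} (hc : Complex.cosh ζ ≠ 0) :
    1 + Complex.tanh ζ = Complex.exp ζ / Complex.cosh ζ := by
  rw [← Complex.cosh_add_sinh, Complex.tanh_eq_sinh_div_cosh]
  field_simp

theorem one_sub_tanh {ζ : ℂ} (hc : Complex.cosh ζ ≠ 0) :
    1 - Complex.tanh ζ = Complex.exp (-ζ) / Complex.cosh ζ := by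
  rw [← Complex.cosh_sub_sinh, Complex.tanh_eq_sinh_div_cosh]
  field_simp

theorem one_sub_tanh_sq {ζ : ℂ} (hc : Complex.cosh ζ ≠ 0) :
    1 - Complex.tanh ζ ^ 2 = (Complex.cosh ζ ^ 2)⁻¹ := by
  have := Complex.cosh_sq_sub_sinh_sq ζ
  rw [Complex.tanh_eq_sinh_div_cosh]
  field_simp
  linear_combination this

/-- The Cayley transform turns `tanh` into `exp (2ζ)`. Moduli then give the sector condition on `Re
ζ`, and logarithms give injectivity and surjectivity of `tanh` from the strip to the disc. -/
theorem one_add_tanh_eq_exp_mul {ζ : ℂ} (hc : Complex.cosh ζ ≠ 0) :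
    1 + Complex.tanh ζ = Complex.exp (2 * ζ) * (1 - Complex.tanh ζ) := by
  rw [one_add_tanh hc, one_sub_tanh hc, ← mul_div_assoc, ← Complex.exp_add]
  congr 2
  ring

theorem hasDerivAt_tanh {ζ : ℂ} (hc : Complex.cosh ζ ≠ 0) :
    HasDerivAt Complex.tanh (Complex.cosh ζ ^ 2)⁻¹ ζ := by
  have h := (Complex.hasDerivAt_sinh ζ).div (Complex.hasDerivAt_cosh ζ) hc
  have e : Complex.tanh = fun x => Complex.sinh x / Complex.cosh x :=
    funext Complex.tanh_eq_sinh_div_cosh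
  rw [e]
  refine HasDerivAt.congr_deriv h ?_
  have := Complex.cosh_sq_sub_sinh_sq ζ
  field_simp
  linear_combination this

/-- The strip `0 ≤ Re ζ < s`, `|Im ζ| < π/4`. -/
def strip (s : ℝ) : Set ℂ := Set.Ico 0 s ×ℂ Set.Ioo (-(Real.pi / 4)) (Real.pi / 4)

/-- The part of the disc between the geodesics through `0` and `tanh s` orthogonal to the real
axis. -/
def discSector (s : ℝ) : Set ℂ :=
  {w | ‖1 - w‖ ≤ ‖1 + w‖ ∧ ‖1 + w‖ < Real.exp (2 * s) * ‖1 - w‖}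

theorem measurableSet_discSector (s : ℝ) : MeasurableSet (discSector s) :=
  MeasurableSet.inter (s₁ := {w : ℂ | ‖1 - w‖ ≤ ‖1 + w‖})
    (s₂ := {w : ℂ | ‖1 + w‖ < Real.exp (2 * s) * ‖1 - w‖})
    (isClosed_le (by fun_prop) (by fun_prop)).measurableSet
    (isOpen_lt (by fun_prop) (by fun_prop)).measurableSet

theorem mem_strip {s : ℝ} {ζ : ℂ} :
    ζ ∈ strip s ↔ (0 ≤ ζ.re ∧ ζ.re < s) ∧ |ζ.im| < Real.pi / 4 := by
  rw [strip, Complex.mem_reProdIm, abs_lt]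
  rfl

theorem one_sub_ne_zero_of_norm_lt {w : ℂ} (hw : ‖w‖ < 1) : 1 - w ≠ 0 := by
  intro h
  rw [← sub_eq_zero.mp h, norm_one] at hw
  exact lt_irrefl _ hw

theorem tanh_mem_discSector {s : ℝ} {ζ : ℂ} (h : |ζ.im| < Real.pi / 4) :
    Complex.tanh ζ ∈ discSector s ↔ 0 ≤ ζ.re ∧ ζ.re < s := by
  have hc := cosh_ne_zero_of_abs_im_lt h
  have h1 := norm_pos_iff.mpr (one_sub_ne_zero_of_norm_lt (norm_tanh_lt_one h))
  have h2 : ‖1 + Complex.tanh ζ‖ = Real.exp (2 * ζ.re) * ‖1 - Complex.tanh ζ‖ := by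
    rw [one_add_tanh_eq_exp_mul hc, norm_mul, Complex.norm_exp]
    simp
  rw [discSector, Set.mem_ofPred_eq, h2, le_mul_iff_one_le_left h1, mul_lt_mul_iff_left₀ h1,
    Real.one_le_exp_iff, Real.exp_lt_exp]
  constructor <;> rintro ⟨h3, h4⟩ <;> constructor <;> linarith

theorem exists_tanh_eq {w : ℂ} (hw : ‖w‖ < 1) :
    ∃ ζ : ℂ, |ζ.im| < Real.pi / 4 ∧ Complex.tanh ζ = w := by
  have h1 := one_sub_ne_zero_of_norm_lt hw
  have h1' : 1 + w ≠ 0 := by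
    have := one_sub_ne_zero_of_norm_lt (w := -w) (by rwa [norm_neg])
    rwa [sub_neg_eq_add] at this
  set u := (1 + w) / (1 - w) with hu
  have hu0 : u ≠ 0 := div_ne_zero h1' h1
  have hre : 0 < u.re := by
    have e : u = ((1 + w) * conj (1 - w)) * ((‖1 - w‖ ^ 2 : ℝ) : ℂ)⁻¹ := by
      have h2 : conj (1 - w) ≠ 0 := (map_ne_zero _).mpr h1
      rw [Complex.ofReal_pow, ← Complex.mul_conj', hu]
      field_simp
    rw [e, ← Complex.ofReal_inv, Complex.re_mul_ofReal]
    have h3 : 0 < ‖1 - w‖ := norm_pos_iff.mpr h1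
    have h4 : ((1 + w) * conj (1 - w)).re = 1 - ‖w‖ ^ 2 := by
      rw [← Complex.normSq_eq_norm_sq, Complex.normSq_apply]
      simp
      ring
    have h5 : ‖w‖ ^ 2 < 1 := (sq_lt_one_iff₀ (norm_nonneg _)).mpr hw
    rw [h4]
    have : 0 < 1 - ‖w‖ ^ 2 := by linarith
    positivity
  -- The Cayley transform `u` lies in the right half plane, so `|arg u| < π/2` and halving the
  -- logarithm lands in the strip.
  refine ⟨Complex.log u / 2, ?_, ?_⟩
  · have := Complex.abs_arg_lt_pi_div_two_iff.mpr (Or.inl hre)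
    have e : (Complex.log u / 2).im = u.arg / 2 := by
      rw [← Complex.log_im]; simp
    rw [e, abs_div, abs_two]
    linarith
  · have him : |(Complex.log u / 2).im| < Real.pi / 4 := by
      have := Complex.abs_arg_lt_pi_div_two_iff.mpr (Or.inl hre)
      have e : (Complex.log u / 2).im = u.arg / 2 := by
        rw [← Complex.log_im]; simp
      rw [e, abs_div, abs_two]
      linarith
    have h := one_add_tanh_eq_exp_mul (cosh_ne_zero_of_abs_im_lt him)
    rw [mul_div_cancel₀ _ (two_ne_zero), Complex.exp_log hu0, hu] at h
    field_simp at h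
    linear_combination (1 / 2 : ℂ) * h

theorem injOn_tanh : Set.InjOn Complex.tanh {ζ | |ζ.im| < Real.pi / 4} := by
  intro ζ hζ ξ hξ h
  have hpi := Real.pi_pos
  have e1 := one_add_tanh_eq_exp_mul (cosh_ne_zero_of_abs_im_lt hζ)
  have e2 := one_add_tanh_eq_exp_mul (cosh_ne_zero_of_abs_im_lt hξ)
  rw [h] at e1
  have h1 := one_sub_ne_zero_of_norm_lt (norm_tanh_lt_one hξ)
  have h2 : Complex.exp (2 * ζ) = Complex.exp (2 * ξ) := mul_right_cancel₀ h1 (e1.symm.trans e2)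
  have hlog : ∀ ζ : ℂ, |ζ.im| < Real.pi / 4 → Complex.log (Complex.exp (2 * ζ)) = 2 * ζ := by
    intro ζ hζ
    obtain ⟨h1, h2⟩ := abs_lt.mp hζ
    have e : (2 * ζ).im = 2 * ζ.im := by simp
    apply Complex.log_exp <;> rw [e] <;> linarith
  have h3 := congrArg Complex.log h2
  rw [hlog ζ hζ, hlog ξ hξ] at h3
  exact mul_left_cancel₀ two_ne_zero h3

theorem image_tanh_strip (s : ℝ) :
    Complex.tanh '' strip s = Metric.ball 0 1 ∩ discSector s := by
  ext w
  constructor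
  · rintro ⟨ζ, hζ, rfl⟩
    obtain ⟨h1, h2⟩ := mem_strip.mp hζ
    exact ⟨mem_ball_zero_iff.mpr (norm_tanh_lt_one h2), (tanh_mem_discSector h2).mpr h1⟩
  · rintro ⟨hw, hs⟩
    obtain ⟨ζ, h, rfl⟩ := exists_tanh_eq (mem_ball_zero_iff.mp hw)
    exact ⟨ζ, mem_strip.mpr ⟨(tanh_mem_discSector h).mp hs, h⟩, rfl⟩

theorem det_smul_one (c : ℂ) : (c • (1 : ℂ →L[ℝ] ℂ)).det = ‖c‖ ^ 2 := by
  rw [← Complex.normSq_eq_norm_sq, ← Algebra.norm_complex_apply, Algebra.norm_apply]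
  rfl

/-- The sector stays away from `±1`: `|1 + w|` is the larger of two numbers with sum at least 2, and
`|1 - w|` is at least `e^{-2s}` times it. -/
theorem exp_neg_le_norm_of_mem_discSector {s : ℝ} {w : ℂ} (h : w ∈ discSector s) :
    Real.exp (-(2 * s)) ≤ ‖1 - w ^ 2‖ := by
  obtain ⟨h1, h2⟩ := h
  have h3 : 1 ≤ ‖1 + w‖ := by
    have h4 : (2 : ℝ) ≤ ‖1 - w‖ + ‖1 + w‖ := by
      have := norm_add_le (1 - w) (1 + w)
      have e : (1 - w) + (1 + w) = 2 := by ring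
      rw [e] at this
      simpa using this
    linarith
  have h5 : Real.exp (-(2 * s)) ≤ ‖1 - w‖ := by
    rw [Real.exp_neg, inv_le_iff_one_le_mul₀' (Real.exp_pos _)]
    linarith
  have e : 1 - w ^ 2 = (1 - w) * (1 + w) := by ring
  rw [e, norm_mul]
  nlinarith [norm_nonneg (1 - w)]

/-- The weight `(1 - w²)^{-m}`, conjugated and cut off to a sector of the disc. -/
def sectorWeight (m : ℕ) (s : ℝ) : ℂ → ℂ :=
  (discSector s).indicator fun w => (conj ((1 - w ^ 2) ^ m))⁻¹

theorem measurable_sectorWeight (m : ℕ) (s : ℝ) : Measurable (sectorWeight m s) := by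
  refine Measurable.indicator ?_ (measurableSet_discSector s)
  exact (Continuous.measurable (by fun_prop)).inv

theorem norm_sectorWeight_le (m : ℕ) (s : ℝ) (w : ℂ) :
    ‖sectorWeight m s w‖ ≤ Real.exp (2 * s) ^ m := by
  by_cases h : w ∈ discSector s
  · rw [sectorWeight, Set.indicator_of_mem h, norm_inv, RCLike.norm_conj, norm_pow, ← inv_pow]
    have h1 := exp_neg_le_norm_of_mem_discSector h
    gcongr
    rw [Real.exp_neg] at h1
    exact inv_le_of_inv_le₀ (Real.exp_pos _) h1
  · rw [sectorWeight, Set.indicator_of_notMem h, norm_zero]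
    positivity

/-- The pull-back of `F(w) (1 - w²)^m` to the strip. -/
def stripLift (m : ℕ) (F : ℂ → ℂ) (ζ : ℂ) : ℂ := F (Complex.tanh ζ) * (Complex.cosh ζ ^ (2 * m))⁻¹

theorem differentiableAt_stripLift (m : ℕ) {F : ℂ → ℂ}
    (hF : DifferentiableOn ℂ F (Metric.ball 0 1)) {ζ : ℂ} (h : |ζ.im| < Real.pi / 4) :
    DifferentiableAt ℂ (stripLift m F) ζ := by
  have hc := cosh_ne_zero_of_abs_im_lt h
  have h1 : DifferentiableAt ℂ F (Complex.tanh ζ) := hF.differentiableAt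
    (Metric.isOpen_ball.mem_nhds (mem_ball_zero_iff.mpr (norm_tanh_lt_one h)))
  have h2 := h1.comp ζ (hasDerivAt_tanh hc).differentiableAt
  refine h2.mul (DifferentiableAt.inv ?_ (pow_ne_zero _ hc))
  fun_prop

/-- Cauchy's theorem on the rectangle with horizontal sides at heights `0` and `θ`; periodicity
cancels the vertical sides. -/
theorem integral_horizontal_eq {H : ℂ → ℂ} {s : ℝ}
    (hH : ∀ ζ : ℂ, |ζ.im| < Real.pi / 4 → DifferentiableAt ℂ H ζ)
    (hper : ∀ ζ : ℂ, |ζ.im| < Real.pi / 4 → H (ζ + s) = H ζ) {θ : ℝ} (hθ : |θ| < Real.pi / 4) :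
    ∫ t in (0 : ℝ)..s, H (t + θ * Complex.I) = ∫ t in (0 : ℝ)..s, H t := by
  have h := Complex.integral_boundary_rect_eq_zero_of_differentiableOn H 0 (s + θ * Complex.I) ?_
  · simp only [Complex.zero_re, Complex.zero_im, Complex.add_re, Complex.add_im, Complex.ofReal_re,
      Complex.ofReal_im, Complex.mul_re, Complex.mul_im, Complex.I_re, Complex.I_im, mul_zero,
      mul_one, sub_zero, add_zero, zero_add, zero_mul, Complex.ofReal_zero] at h
    have h2 : ∫ y in (0 : ℝ)..θ, H (s + y * Complex.I) = ∫ y in (0 : ℝ)..θ, H (y * Complex.I) := by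
      refine intervalIntegral.integral_congr fun y hy => ?_
      have : |y| < Real.pi / 4 := by
        have := Set.abs_sub_left_of_mem_uIcc hy
        simp only [sub_zero] at this
        exact this.trans_lt hθ
      change H (s + y * Complex.I) = H (y * Complex.I)
      rw [add_comm, hper]
      simpa using this
    rw [h2, add_sub_cancel_right] at h
    exact (sub_eq_zero.mp h).symm
  · intro ζ hζ
    refine (hH ζ ?_).differentiableWithinAt
    have h1 := (Complex.mem_reProdIm.mp hζ).2
    simp only [Complex.zero_im, Complex.add_im, Complex.ofReal_im, Complex.mul_im,
      Complex.ofReal_re,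
      Complex.I_im, Complex.I_re, mul_one, mul_zero, zero_add, add_zero] at h1
    have := Set.abs_sub_left_of_mem_uIcc h1
    simp only [sub_zero] at this
    exact this.trans_lt hθ

theorem setIntegral_disc_eq {F : ℂ → ℂ} (hF : DifferentiableOn ℂ F (Metric.ball 0 1)) {m : ℕ}
    (hm : 2 ≤ m) {s : ℝ} (hs : 0 < s) {K : ℝ}
    (hK : ∀ w ∈ Metric.ball (0 : ℂ) 1, ‖F w‖ * (1 - ‖w‖ ^ 2) ^ m ≤ K)
    (hper : ∀ ζ : ℂ, |ζ.im| < Real.pi / 4 → stripLift m F (ζ + s) = stripLift m F ζ) :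
    ∫ w in Metric.ball (0 : ℂ) 1,
      F w * (sectorWeight m s w * ((1 - ‖w‖ ^ 2 : ℝ) : ℂ) ^ (2 * (m - 1))) =
    (∫ θ in -(Real.pi / 4)..Real.pi / 4, Real.cos (2 * θ) ^ (2 * (m - 1)) : ℝ) *
      ∫ t in (0 : ℝ)..s, stripLift m F t := by
  set g : ℂ → ℂ := fun w =>
    F w * ((conj ((1 - w ^ 2) ^ m))⁻¹ * ((1 - ‖w‖ ^ 2 : ℝ) : ℂ) ^ (2 * (m - 1))) with hg
  have hball := (Metric.isOpen_ball (x := (0 : ℂ)) (ε := 1)).measurableSet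
  have hsec := measurableSet_discSector s
  have e1 : ∫ w in Metric.ball (0 : ℂ) 1,
      F w * (sectorWeight m s w * ((1 - ‖w‖ ^ 2 : ℝ) : ℂ) ^ (2 * (m - 1))) =
      ∫ w in Metric.ball (0 : ℂ) 1 ∩ discSector s, g w := by
    rw [← setIntegral_indicator hsec]
    refine integral_congr_ae (ae_of_all _ fun w => ?_)
    by_cases hw : w ∈ discSector s
    · simp [hg, sectorWeight, hw]
    · simp [sectorWeight, hw]
  have hgi : IntegrableOn g (Metric.ball (0 : ℂ) 1 ∩ discSector s) := by
    have hfin : volume (Metric.ball (0 : ℂ) 1 ∩ discSector s) < ⊤ :=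
      (measure_mono Set.inter_subset_left).trans_lt measure_ball_lt_top
    refine IntegrableOn.of_bound hfin ?_ (K * Real.exp (2 * s) ^ m) ?_
    · refine AEStronglyMeasurable.mono_set Set.inter_subset_left ?_
      refine AEStronglyMeasurable.mul (hF.continuousOn.aestronglyMeasurable hball) ?_
      refine Measurable.aestronglyMeasurable (Measurable.mul (Measurable.inv ?_) ?_)
      · exact Continuous.measurable (by fun_prop)
      · exact Continuous.measurable (by fun_prop)
    · filter_upwards [ae_restrict_mem (hball.inter hsec)] with w ⟨hw1, hw2⟩
      have h1 := hK w hw1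
      have h2 := norm_sectorWeight_le m s w
      rw [sectorWeight, Set.indicator_of_mem hw2] at h2
      have h3 : 0 ≤ 1 - ‖w‖ ^ 2 := sub_nonneg.mpr
        ((sq_lt_one_iff₀ (norm_nonneg _)).mpr (mem_ball_zero_iff.mp hw1)).le
      simp only [hg]
      rw [norm_mul, norm_mul, norm_pow, Complex.norm_real, Real.norm_of_nonneg h3]
      calc _ ≤ ‖F w‖ * (‖(conj ((1 - w ^ 2) ^ m))⁻¹‖ * (1 - ‖w‖ ^ 2) ^ m) := by
            gcongr _ * (_ * ?_)
            -- The exponents satisfy `m ≤ 2 * (m - 1)` because `2 ≤ m`.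
            exact pow_le_pow_of_le_one h3 (by linarith [sq_nonneg ‖w‖]) (by omega)
        _ = ‖F w‖ * (1 - ‖w‖ ^ 2) ^ m * ‖(conj ((1 - w ^ 2) ^ m))⁻¹‖ := by ring
        _ ≤ _ := mul_le_mul h1 h2 (norm_nonneg _) ((by positivity : (0 : ℝ) ≤ _).trans h1)
  have hstrip : MeasurableSet (strip s) := by
    rw [strip]
    exact (measurableSet_Ico.preimage Complex.measurable_re).inter
      (measurableSet_Ioo.preimage Complex.measurable_im)
  have him : ∀ ζ ∈ strip s, |ζ.im| < Real.pi / 4 := fun ζ hζ => (mem_strip.mp hζ).2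
  have hder : ∀ ζ ∈ strip s, HasFDerivWithinAt Complex.tanh
      ((Complex.cosh ζ ^ 2)⁻¹ • (1 : ℂ →L[ℝ] ℂ)) (strip s) ζ := fun ζ hζ =>
    (hasDerivAt_tanh (cosh_ne_zero_of_abs_im_lt (him ζ hζ))).complexToReal_fderiv.hasFDerivWithinAt
  have hinj : Set.InjOn Complex.tanh (strip s) := injOn_tanh.mono him
  -- The Jacobian is `|cosh ζ|⁻⁴`, the power of `1 - |w|²` gives `|cosh ζ|^{-4(m-1)}`, and the
  -- conjugated weight gives `conj (cosh ζ)^{2m}`. All conjugate powers cancel, leaving a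
  -- holomorphic factor times a function of `Im ζ`.
  have hpull : ∀ ζ ∈ strip s, |((Complex.cosh ζ ^ 2)⁻¹ • (1 : ℂ →L[ℝ] ℂ)).det| •
      g (Complex.tanh ζ) = stripLift m F ζ * ((Real.cos (2 * ζ.im) ^ (2 * (m - 1)) : ℝ) : ℂ) := by
    intro ζ hζ
    have hc := cosh_ne_zero_of_abs_im_lt (him ζ hζ)
    have hc' : conj (Complex.cosh ζ) ≠ 0 := (map_ne_zero _).mpr hc
    obtain ⟨k, rfl⟩ : ∃ k, m = k + 1 := ⟨m - 1, by omega⟩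
    rw [det_smul_one, abs_of_nonneg (by positivity), Complex.real_smul, hg]
    simp only
    rw [one_sub_norm_tanh_sq (him ζ hζ), one_sub_tanh_sq hc, Complex.ofReal_pow,
      ← Complex.mul_conj', stripLift]
    simp only [map_inv₀, map_pow, Nat.add_sub_cancel, Complex.ofReal_pow]
    rw [inv_pow, inv_inv, ← pow_mul, div_pow]
    field_simp
    ring
  rw [e1, ← image_tanh_strip, integral_image_eq_integral_abs_det_fderiv_smul volume hstrip hder
    hinj, setIntegral_congr_fun hstrip hpull]
  rw [← image_tanh_strip, integrableOn_image_iff_integrableOn_abs_det_fderiv_smul volume hstrip hder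
    hinj, integrableOn_congr_fun hpull hstrip] at hgi
  have hmp := Complex.volume_preserving_equiv_real_prod.symm
  set h : ℂ → ℂ := fun ζ => stripLift m F ζ * ((Real.cos (2 * ζ.im) ^ (2 * (m - 1)) : ℝ) : ℂ)
    with hh
  have hpre : Complex.measurableEquivRealProd.symm ⁻¹' strip s =
      Set.Ico 0 s ×ˢ Set.Ioo (-(Real.pi / 4)) (Real.pi / 4) := by
    ext p
    simp [strip, Complex.mem_reProdIm, Complex.measurableEquivRealProd]
  have e2 : ∫ ζ in strip s, h ζ = ∫ p in Set.Ico 0 s ×ˢ Set.Ioo (-(Real.pi / 4)) (Real.pi / 4),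
      h (Complex.measurableEquivRealProd.symm p) := by
    rw [← hpre]
    exact (hmp.setIntegral_preimage_emb
      Complex.measurableEquivRealProd.symm.measurableEmbedding h (strip s)).symm
  have hi2 : IntegrableOn (fun p => h (Complex.measurableEquivRealProd.symm p))
      (Set.Ico 0 s ×ˢ Set.Ioo (-(Real.pi / 4)) (Real.pi / 4)) := by
    rw [← hpre]
    exact (hmp.integrableOn_comp_preimage
      Complex.measurableEquivRealProd.symm.measurableEmbedding).mpr hgi
  have hpi := Real.pi_pos
  have hi3 := hi2
  rw [IntegrableOn, Measure.volume_eq_prod, ← Measure.prod_restrict] at hi3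
  rw [e2, Measure.volume_eq_prod, ← Measure.prod_restrict, integral_prod_symm _ hi3,
    intervalIntegral.integral_of_le (by linarith), integral_Ioc_eq_integral_Ioo,
    ← integral_complex_ofReal, ← integral_mul_const]
  refine setIntegral_congr_fun measurableSet_Ioo fun θ hθ => ?_
  have e3 : ∀ t : ℝ, h (Complex.measurableEquivRealProd.symm (t, θ)) =
      ((Real.cos (2 * θ) ^ (2 * (m - 1)) : ℝ) : ℂ) * stripLift m F (t + θ * Complex.I) := by
    intro t
    have e4 : Complex.measurableEquivRealProd.symm (t, θ) = t + θ * Complex.I := by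
      apply Complex.ext <;> simp [Complex.measurableEquivRealProd]
    rw [e4, hh]
    simp
    ring
  simp only [e3]
  rw [integral_const_mul, integral_Ico_eq_integral_Ioo, ← integral_Ioc_eq_integral_Ioo,
    ← intervalIntegral.integral_of_le hs.le, integral_horizontal_eq
      (fun ζ hζ => differentiableAt_stripLift m hF hζ) hper (abs_lt.mpr hθ)]

end DiscIntegral

/-! ### Topology of `SU(n,1)`, regularity of the functions involved, and transfer between measures.
-/

section GroupMeasure

variable {n : ℕ}

theorem isEmbedding_mat (n : ℕ) : Topology.IsEmbedding fun g : SU n => mat g :=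
  Topology.IsEmbedding.subtypeVal.comp Topology.IsEmbedding.subtypeVal

instance (n : ℕ) : SecondCountableTopology (SU n) :=
  have : SecondCountableTopology (Matrix (Idx n) (Idx n) ℂ) :=
    inferInstanceAs (SecondCountableTopology (Idx n → Idx n → ℂ))
  (isEmbedding_mat n).secondCountableTopology

theorem countable_of_discrete (Γ : Subgroup (SU n)) [DiscreteTopology Γ] : Countable Γ :=
  countable_of_Lindelof_of_discrete

theorem continuous_mat_mulVec (v : Idx n → ℂ) : Continuous fun g : SU n => mat g *ᵥ v :=
  Continuous.matrix_mulVec (isEmbedding_mat n).continuous continuous_const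

theorem continuous_mat_mulVec_apply (v : Idx n → ℂ) (i : Idx n) :
    Continuous fun g : SU n => (mat g *ᵥ v) i :=
  (continuous_apply i).comp (continuous_mat_mulVec v)

theorem continuous_smul_origin (n : ℕ) : Continuous fun g : SU n => g • origin n := by
  refine Continuous.subtype_mk (continuous_pi fun _ => ?_) _
  exact (continuous_mat_mulVec_apply _ _).div (continuous_mat_mulVec_apply _ _)
    fun g => mat_emb_ne_zero g (origin n)

theorem continuous_autFactor_origin (n : ℕ) :
    Continuous fun g : SU n => autFactor g (origin n) :=
  (continuous_mat_mulVec_apply _ _).inv₀ fun g => mat_emb_ne_zero g (origin n)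

theorem continuous_lift (k : ℕ) {f : Ball n → ℂ} (hf : Continuous f) : Continuous (lift k f) :=
  (hf.comp (continuous_smul_origin n)).mul ((continuous_autFactor_origin n).pow k)

theorem differentiable_mulVec_emb (A : Matrix (Idx n) (Idx n) ℂ) (i : Idx n) :
    Differentiable ℂ fun z : Fin n → ℂ => (A *ᵥ emb z) i := by
  simp only [mulVec, dotProduct, Fintype.sum_sum_type, emb, Sum.elim_inl, Sum.elim_inr]
  fun_prop

theorem continuous_emb_mulVec (g : SU n) (i : Idx n) :
    Continuous fun z : Ball n => (mat g *ᵥ emb z.1) i :=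
  (differentiable_mulVec_emb (mat g) i).continuous.comp continuous_subtype_val

theorem continuous_smul_ball (g : SU n) : Continuous fun z : Ball n => g • z :=
  Continuous.subtype_mk (continuous_pi fun _ => (continuous_emb_mulVec g _).div
    (continuous_emb_mulVec g _) fun z => mat_emb_ne_zero g z) _

theorem continuous_slash (k : ℕ) {f : Ball n → ℂ} (hf : Continuous f) (g : SU n) :
    Continuous (slash k f g) :=
  (hf.comp (continuous_smul_ball g)).mul
    (((continuous_emb_mulVec g _).inv₀ fun z => mat_emb_ne_zero g z).pow k)

theorem quad_ne_zero {X Y : Fin n → ℂ} (hX : ∑ j, ‖X j‖ ^ 2 = 1) (hY : ∑ j, ‖Y j‖ ^ 2 = 1)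
    (z : Ball n) : quad X Y z ≠ 0 :=
  mul_ne_zero (herm_ne_zero_of_neg_of_null (emb_neg z) (emb_null hX) (emb_ne_zero X))
    (herm_ne_zero_of_neg_of_null (emb_neg z) (emb_null hY) (emb_ne_zero Y))

theorem continuous_herm_emb (X : Fin n → ℂ) :
    Continuous fun z : Ball n => herm (emb z.1) (emb X) := by
  simp only [herm, emb, Sum.elim_inl, Sum.elim_inr]
  exact (continuous_finsetSum _ fun j _ => ((continuous_apply j).comp
    continuous_subtype_val).mul continuous_const).sub continuous_const

theorem continuous_seed (m : ℕ) {X Y : Fin n → ℂ} (hX : ∑ j, ‖X j‖ ^ 2 = 1)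
    (hY : ∑ j, ‖Y j‖ ^ 2 = 1) : Continuous (seed m X Y) := by
  refine Continuous.inv₀ ?_ fun z => pow_ne_zero _ (quad_ne_zero hX hY z)
  refine Continuous.pow ?_ m
  exact (continuous_herm_emb X).mul (continuous_herm_emb Y)

theorem exists_holomorphic_slash (k : ℕ) {f : Ball n → ℂ} {F : (Fin n → ℂ) → ℂ}
    (hF : DifferentiableOn ℂ F (unitBall n)) (hfF : ∀ z : Ball n, f z = F z.1) (g : SU n) :
    ∃ F' : (Fin n → ℂ) → ℂ, DifferentiableOn ℂ F' (unitBall n) ∧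
      ∀ z : Ball n, slash k f g z = F' z.1 := by
  have h0 : ∀ z ∈ unitBall n, (mat g *ᵥ emb z) (Sum.inr ()) ≠ 0 := fun z hz =>
    mat_emb_ne_zero g ⟨z, hz⟩
  refine ⟨fun z => F (fun i => (mat g *ᵥ emb z) (Sum.inl i) / (mat g *ᵥ emb z) (Sum.inr ())) *
    ((mat g *ᵥ emb z) (Sum.inr ()))⁻¹ ^ k, ?_, ?_⟩
  · refine DifferentiableOn.mul (hF.comp (t := unitBall n) ?_ ?_) (DifferentiableOn.pow ?_ k)
    · refine differentiableOn_pi.mpr fun i => ?_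
      simp only [div_eq_mul_inv]
      exact (differentiable_mulVec_emb _ _).differentiableOn.mul
        ((differentiable_mulVec_emb _ _).differentiableOn.inv h0)
    · intro z hz
      exact (g • (⟨z, hz⟩ : Ball n)).2
    · exact (differentiable_mulVec_emb _ _).differentiableOn.inv h0
  · intro z
    rw [slash, hfF]
    rfl

theorem continuous_of_holomorphic {f : Ball n → ℂ} {F : (Fin n → ℂ) → ℂ}
    (hF : DifferentiableOn ℂ F (unitBall n)) (hfF : ∀ z : Ball n, f z = F z.1) : Continuous f := by
  rw [funext hfF]
  exact continuousOn_iff_continuous_domRestrict.mp hF.continuousOn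

theorem continuous_sum_norm_sq (n : ℕ) : Continuous fun z : Ball n => ∑ j, ‖z.1 j‖ ^ 2 :=
  (by fun_prop : Continuous fun z : Fin n → ℂ => ∑ j, ‖z j‖ ^ 2).comp continuous_subtype_val

/-- The density of the invariant volume with respect to Lebesgue measure. -/
def hypDensity (n : ℕ) (z : Fin n → ℂ) : ℝ := 4 ^ n / (1 - ∑ j, ‖z j‖ ^ 2) ^ (n + 1)

theorem hypDensity_pos {z : Fin n → ℂ} (hz : z ∈ unitBall n) : 0 < hypDensity n z := by
  have : 0 < 1 - ∑ j, ‖z j‖ ^ 2 := sub_pos.mpr hz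
  unfold hypDensity
  positivity

theorem measurable_hypDensity (n : ℕ) :
    Measurable fun z : Ball n => ENNReal.ofReal (hypDensity n z.1) := by
  refine Measurable.ennreal_ofReal (Measurable.div measurable_const ?_)
  exact ((continuous_const.sub (continuous_sum_norm_sq n)).pow _).measurable

theorem hypVolume_eq (n : ℕ) : hypVolume n =
    (Measure.comap Subtype.val (volume : Measure (Fin n → ℂ))).withDensity
      fun z => ENNReal.ofReal (hypDensity n z.1) := rfl

theorem measurableEmbedding_val (n : ℕ) : MeasurableEmbedding (Subtype.val : Ball n → Fin n → ℂ) :=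
  MeasurableEmbedding.subtype_coe (isOpen_unitBall n).measurableSet

theorem map_val_comap (n : ℕ) :
    (Measure.comap (Subtype.val : Ball n → Fin n → ℂ) volume).map Subtype.val =
      volume.restrict (unitBall n) := by
  rw [(measurableEmbedding_val n).map_comap]
  exact congrArg _ Subtype.range_coe

theorem integrable_hypVolume_iff (G : (Fin n → ℂ) → ℂ) :
    Integrable (fun z : Ball n => G z.1) (hypVolume n) ↔
      IntegrableOn (fun z => (hypDensity n z : ℂ) * G z) (unitBall n) := by
  rw [hypVolume_eq, integrable_withDensity_iff_integrable_smul' (measurable_hypDensity n)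
    (ae_of_all _ fun z => ENNReal.ofReal_lt_top), IntegrableOn, ← map_val_comap,
    (measurableEmbedding_val n).integrable_map_iff]
  refine iff_of_eq (congrArg (Integrable · _) (funext fun z => ?_))
  rw [ENNReal.toReal_ofReal (hypDensity_pos z.2).le, Complex.real_smul]
  rfl

theorem integral_hypVolume (G : (Fin n → ℂ) → ℂ) :
    ∫ z : Ball n, G z.1 ∂(hypVolume n) =
      ∫ z in unitBall n, (hypDensity n z : ℂ) * G z := by
  rw [hypVolume_eq, integral_withDensity_eq_integral_toReal_smul (measurable_hypDensity n)
    (ae_of_all _ fun z => ENNReal.ofReal_lt_top), ← map_val_comap,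
    (measurableEmbedding_val n).integral_map]
  refine integral_congr_ae (ae_of_all _ fun z => ?_)
  simp only [ENNReal.toReal_ofReal (hypDensity_pos z.2).le, Complex.real_smul]

theorem eq_empty_of_hypVolume_eq_zero {U : Set (Ball n)} (hU : IsOpen U) (h : hypVolume n U = 0) :
    U = ∅ := by
  have h1 : Measure.comap (Subtype.val : Ball n → Fin n → ℂ) volume U = 0 := by
    rw [hypVolume_eq, withDensity_apply_eq_zero' (measurable_hypDensity n).aemeasurable] at h
    convert h using 2
    refine (Set.inter_eq_right.mpr fun z _ => ?_).symm
    exact (ENNReal.ofReal_pos.mpr (hypDensity_pos z.2)).ne'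
  rw [(measurableEmbedding_val n).comap_apply] at h1
  have h2 : IsOpen (Subtype.val '' U) := (isOpen_unitBall n).isOpenMap_subtype_val U hU
  exact Set.image_eq_empty.mp (h2.measure_eq_zero_iff volume |>.mp h1)

variable {μ : Measure (SU n)}

/-- The bound is immediate at points `g(0)`. The open set where it fails has no preimage in the
group, so by `hμ` it has volume zero and is empty; transitivity of the action is not invoked. -/
theorem norm_mul_le_of_lift_le (hμ : μ.map (fun g => g • origin n) = hypVolume n) (m : ℕ)
    {f : Ball n → ℂ} (hf : Continuous f) {M : ℝ} (hM : ∀ g, ‖lift (2 * m) f g‖ ≤ M) (z : Ball n) :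
    ‖f z‖ * (1 - ∑ j, ‖z.1 j‖ ^ 2) ^ m ≤ M := by
  have hopen : IsOpen {z : Ball n | M < ‖f z‖ * (1 - ∑ j, ‖z.1 j‖ ^ 2) ^ m} :=
    isOpen_lt continuous_const
      (hf.norm.mul ((continuous_const.sub (continuous_sum_norm_sq n)).pow m))
  have h : hypVolume n {z : Ball n | M < ‖f z‖ * (1 - ∑ j, ‖z.1 j‖ ^ 2) ^ m} = 0 := by
    rw [← hμ, Measure.map_apply (continuous_smul_origin n).measurable hopen.measurableSet]
    convert measure_empty (μ := μ)
    refine Set.eq_empty_of_forall_notMem fun g hg => ?_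
    have := hM g
    rw [norm_lift] at this
    exact absurd hg (not_lt.mpr this)
  have h2 := eq_empty_of_hypVolume_eq_zero hopen h
  by_contra hz
  exact (h2 ▸ (show z ∈ {z : Ball n | M < ‖f z‖ * (1 - ∑ j, ‖z.1 j‖ ^ 2) ^ m} from not_le.mp hz) :
    z ∈ (∅ : Set (Ball n)))

end GroupMeasure

/-! ### The integral over the slab for the standard axis, with its constant. -/

section StandardPeriod

variable {n : ℕ} [NeZero n]

/-- The constant of the period formula without the factor depending on the fixed points. -/
def stdPeriodConst (n m : ℕ) : ℝ :=
  ((2 * m - n - 1)! : ℝ) / ((m - 1)! : ℝ) ^ 2 * Real.pi ^ n * (2 ^ (2 * n + 1) / 4 ^ m)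

theorem periodConst_eq {n : ℕ} {κ : ℚ} {m : ℕ} (hm : (m : ℚ) = (n + 1) * κ) :
    periodConst n κ m = stdPeriodConst n m := by
  have hm' : (m : ℝ) = (n + 1) * κ := by exact_mod_cast hm
  have e : 2 * ((n : ℝ) + 1) * (1 - κ) - 1 = ((2 * n + 1 : ℕ) : ℝ) - ((2 * m : ℕ) : ℝ) := by
    push_cast
    rw [hm']
    ring
  rw [periodConst, stdPeriodConst, e, Real.rpow_sub two_pos, Real.rpow_natCast, Real.rpow_natCast,
    pow_mul 2 2 m]
  norm_num

/-- The factors are `4ⁿ` from the invariant volume, the Beta integral over `n - 1` coordinates, and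
the Wallis integral; `(2m - 2)!` cancels between the last two. -/
theorem stdPeriodConst_eq {m : ℕ} (hm : n + 1 ≤ m) : stdPeriodConst n m =
    4 ^ n * (Real.pi ^ (n - 1) * ((2 * m - n - 1)! / (2 * (m - 1))!)) *
      (Real.pi / 2 * ((2 * (m - 1))! / (((m - 1)! : ℝ) ^ 2 * 4 ^ (m - 1)))) := by
  obtain ⟨N, rfl⟩ : ∃ N, n = N + 1 := ⟨n - 1, (Nat.succ_pred_eq_of_ne_zero (NeZero.ne n)).symm⟩
  obtain ⟨k, rfl⟩ : ∃ k, m = k + 1 := ⟨m - 1, by omega⟩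
  have h1 := Nat.factorial_ne_zero k
  have h2 := Nat.factorial_ne_zero (2 * k)
  have e : (2 : ℝ) ^ (2 * (N + 1) + 1) = 2 * 4 ^ (N + 1) := by
    rw [pow_succ, pow_mul]; norm_num; ring
  rw [stdPeriodConst, e]
  simp only [Nat.add_sub_cancel]
  rw [pow_succ 4 k, pow_succ Real.pi]
  field_simp
  norm_num

theorem setIntegral_unitBall_period {m : ℕ} (hm : n + 1 ≤ m) {F : (Fin n → ℂ) → ℂ}
    (hF : DifferentiableOn ℂ F (unitBall n)) {M : ℝ}
    (hM : ∀ z ∈ unitBall n, ‖F z‖ * (1 - ∑ j, ‖z j‖ ^ 2) ^ m ≤ M) {s : ℝ} (hs : 0 < s)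
    (hper : ∀ ζ : ℂ, |ζ.im| < Real.pi / 4 →
      stripLift m (fun w => F (Pi.single (lastIdx n) w)) (ζ + s) =
        stripLift m (fun w => F (Pi.single (lastIdx n) w)) ζ) (A : ℂ) :
    ∫ z : Ball n, F z.1 * (A * sectorWeight m s (z.1 (lastIdx n))) *
      ((1 - ∑ j, ‖z.1 j‖ ^ 2 : ℝ) : ℂ) ^ (2 * m) ∂(hypVolume n) =
    A * stdPeriodConst n m *
      ∫ t in (0 : ℝ)..s, stripLift m (fun w => F (Pi.single (lastIdx n) w)) t := by
  have hn : 0 < n := NeZero.pos n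
  have hB := (isOpen_unitBall n).measurableSet
  set l := lastIdx n
  -- The Petersson weight contributes the exponent `2m`, and the density of `dV` removes `n + 1`.
  set p := 2 * m - n - 1 with hp
  set P : (Fin n → ℂ) → ℂ := fun z =>
    F z * (sectorWeight m s (z l) * ((1 - ∑ j, ‖z j‖ ^ 2 : ℝ) : ℂ) ^ p) with hP
  have hbound : ∀ z ∈ unitBall n, ‖P z‖ ≤ M * Real.exp (2 * s) ^ m := by
    intro z hz
    have h3 : 0 ≤ 1 - ∑ j, ‖z j‖ ^ 2 := sub_nonneg.mpr (le_of_lt hz)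
    have h4 : 0 ≤ ∑ j, ‖z j‖ ^ 2 := Finset.sum_nonneg fun _ _ => by positivity
    have h1 := hM z hz
    simp only [hP]
    rw [norm_mul, norm_mul, norm_pow, Complex.norm_real, Real.norm_of_nonneg h3]
    calc _ ≤ ‖F z‖ * (‖sectorWeight m s (z l)‖ * (1 - ∑ j, ‖z j‖ ^ 2) ^ m) := by
          gcongr _ * (_ * ?_)
          -- The inequality `m ≤ p` is equivalent to `n + 1 ≤ m`.
          exact pow_le_pow_of_le_one h3 (by linarith) (by omega)
      _ = ‖F z‖ * (1 - ∑ j, ‖z j‖ ^ 2) ^ m * ‖sectorWeight m s (z l)‖ := by ring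
      _ ≤ _ := mul_le_mul h1 (norm_sectorWeight_le m s _) (norm_nonneg _)
        ((by positivity : (0 : ℝ) ≤ _).trans h1)
  have hdens : ∀ z ∈ unitBall n, (hypDensity n z : ℂ) *
      (F z * (A * sectorWeight m s (z l)) * ((1 - ∑ j, ‖z j‖ ^ 2 : ℝ) : ℂ) ^ (2 * m)) =
      (4 ^ n * A) * P z := by
    intro z hz
    have h3 : ((1 - ∑ j, ‖z j‖ ^ 2 : ℝ) : ℂ) ≠ 0 :=
      Complex.ofReal_ne_zero.mpr (sub_pos.mpr hz).ne'
    have h4 : 2 * m = p + (n + 1) := by omega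
    simp only [hypDensity, hP]
    rw [h4, Complex.ofReal_div, Complex.ofReal_pow, Complex.ofReal_pow]
    generalize ((1 - ∑ j, ‖z j‖ ^ 2 : ℝ) : ℂ) = r at h3 ⊢
    rw [Complex.ofReal_ofNat]
    field_simp
    ring
  rw [integral_hypVolume (fun z => F z * (A * sectorWeight m s (z l)) *
    ((1 - ∑ j, ‖z j‖ ^ 2 : ℝ) : ℂ) ^ (2 * m)), setIntegral_congr_fun hB hdens,
    integral_const_mul, setIntegral_unitBall_eq_disc hF (measurable_sectorWeight m s)
      (by omega : p ≠ 0) hbound, show p + (n - 1) = 2 * (m - 1) by omega, setIntegral_disc_eq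
      (K := M) ?_ (by omega) hs ?_ hper, integral_cos_two_mul_pow, stdPeriodConst_eq hm]
  · push_cast
    ring
  · refine hF.comp ?_ fun w hw => single_mem_unitBall.mpr (mem_ball_zero_iff.mp hw)
    refine Differentiable.differentiableOn (differentiable_pi.mpr fun i => ?_)
    by_cases hi : i = l
    · subst hi; simp only [Pi.single_eq_same]; fun_prop
    · simp only [Pi.single_eq_of_ne hi]; fun_prop
  · intro w hw
    have := hM _ (single_mem_unitBall.mpr (mem_ball_zero_iff.mp hw))
    rwa [sum_norm_single] at this

end StandardPeriod

/-! ### A fundamental domain for `⟨γ₀⟩` and integrability of the seed on it. -/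

section Unfolded

theorem apply_zpow_smul_add {G α : Type*} [Group G] [MulAction G α] {c : G} {u : α → ℝ} {p : ℝ}
    (h : ∀ x, u (c • x) = u x + p) (k : ℤ) (x : α) : u (c ^ k • x) = u x + k • p := by
  have h' : ∀ x, u (c⁻¹ • x) = u x - p := fun x => by
    rw [eq_sub_iff_add_eq, ← h, smul_inv_smul]
  induction k using Int.induction_on generalizing x with
  | zero => simp
  | succ k ih => rw [_root_.zpow_add_one, mul_smul, ih, h, add_smul, one_smul]; ring
  | pred k ih => rw [_root_.zpow_sub_one, mul_smul, ih, h', sub_smul, one_smul]; ring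

theorem apply_zpow_smul {G α β : Type*} [Group G] [MulAction G α] {c : G} {u : α → β}
    (h : ∀ x, u (c • x) = u x) (k : ℤ) (x : α) : u (c ^ k • x) = u x := by
  have h' : ∀ x, u (c⁻¹ • x) = u x := fun x => by rw [← h, smul_inv_smul]
  induction k using Int.induction_on generalizing x with
  | zero => simp
  | succ k ih => rw [_root_.zpow_add_one, mul_smul, ih, h]
  | pred k ih => rw [_root_.zpow_sub_one, mul_smul, ih, h']

theorem isFundamentalDomain_zpowers {G α : Type*} [Group G] [MulAction G α] [MeasurableSpace α]
    {μ : Measure α} {γ : G} {u : α → ℝ} (hu : Measurable u) {p : ℝ} (hp : 0 < p)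
    (h : ∀ x, u (γ • x) = u x + p) (c₀ : ℝ) :
    IsFundamentalDomain (Subgroup.zpowers γ) {x | u x ∈ Set.Ico c₀ (c₀ + p)} μ := by
  refine IsFundamentalDomain.mk' (hu measurableSet_Ico).nullMeasurableSet fun x => ?_
  obtain ⟨k, hk, huniq⟩ := existsUnique_add_zsmul_mem_Ico hp (u x) c₀
  refine ⟨⟨γ ^ k, k, rfl⟩, ?_, ?_⟩
  · change u (γ ^ k • x) ∈ Set.Ico c₀ (c₀ + p)
    rwa [apply_zpow_smul_add h]
  · rintro ⟨_, k', rfl⟩ hk'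
    change u (γ ^ k' • x) ∈ Set.Ico c₀ (c₀ + p) at hk'
    rw [apply_zpow_smul_add h] at hk'
    have := huniq k' hk'
    subst this
    rfl

variable {n : ℕ}

/-- The logarithm of `|⟨z, X⟩| / |⟨z, Y⟩|`. -/
def heightLog (X Y : Fin n → ℂ) (z : Ball n) : ℝ :=
  Real.log (‖herm (emb z.1) (emb X)‖ / ‖herm (emb z.1) (emb Y)‖)

theorem norm_herm_emb_pos {X : Fin n → ℂ} (hX : ∑ j, ‖X j‖ ^ 2 = 1) (z : Ball n) :
    0 < ‖herm (emb z.1) (emb X)‖ :=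
  norm_pos_iff.mpr (herm_ne_zero_of_neg_of_null (emb_neg z) (emb_null hX) (emb_ne_zero X))

theorem measurable_heightLog (X Y : Fin n → ℂ) : Measurable (heightLog X Y) :=
  ((continuous_herm_emb X).norm.measurable.div (continuous_herm_emb Y).norm.measurable).log

theorem norm_herm_smul_emb_of_eigen {γ : SU n} {X : Fin n → ℂ} {c : ℂ} (hc : c ≠ 0)
    (h : mat γ *ᵥ emb X = c • emb X) (z : Ball n) :
    ‖herm (emb (γ • z).1) (emb X)‖ =
      ‖autFactor γ z‖ * (‖c‖⁻¹ * ‖herm (emb z.1) (emb X)‖) := by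
  have e : emb X = c⁻¹ • mat γ *ᵥ emb X := by rw [h, inv_smul_smul₀ hc]
  conv_lhs => rw [e]
  rw [mat_smul_emb, herm_smul_left, herm_smul_right, herm_mat]
  simp

/-- In the quotient the automorphy factors cancel, while the eigenvalues scale numerator and
denominator by `|λ|` and `|λ|⁻¹`. -/
theorem heightLog_smul {γ : SU n} {X Y : Fin n → ℂ} (hX : ∑ j, ‖X j‖ ^ 2 = 1)
    (hY : ∑ j, ‖Y j‖ ^ 2 = 1) {lam : ℂ} (hlam : lam ≠ 0)
    (hγX : mat γ *ᵥ emb X = (conj lam)⁻¹ • emb X) (hγY : mat γ *ᵥ emb Y = lam • emb Y)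
    (z : Ball n) : heightLog X Y (γ • z) = heightLog X Y z + 2 * Real.log ‖lam‖ := by
  have h1 := norm_herm_emb_pos hX z
  have h2 := norm_herm_emb_pos hY z
  have h3 := norm_pos_iff.mpr hlam
  have h4 := norm_pos_iff.mpr (autFactor_ne_zero γ z)
  rw [heightLog, norm_herm_smul_emb_of_eigen (inv_ne_zero ((map_ne_zero _).mpr hlam)) hγX,
    norm_herm_smul_emb_of_eigen hlam hγY, norm_inv, RCLike.norm_conj, inv_inv]
  have e : ‖autFactor γ z‖ * (‖lam‖ * ‖herm (emb z.1) (emb X)‖) /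
      (‖autFactor γ z‖ * (‖lam‖⁻¹ * ‖herm (emb z.1) (emb Y)‖)) =
      ‖herm (emb z.1) (emb X)‖ / ‖herm (emb z.1) (emb Y)‖ * ‖lam‖ ^ 2 := by
    field_simp
  rw [e, Real.log_mul (by positivity) (by positivity), Real.log_pow, heightLog]
  norm_num

theorem sum_norm_sub_sq_le {X : Fin n → ℂ} (hX : ∑ j, ‖X j‖ ^ 2 = 1) (z : Ball n) :
    ∑ j, ‖z.1 j - X j‖ ^ 2 ≤ 2 * ‖herm (emb z.1) (emb X)‖ := by
  have h1 : ∑ j, ‖z.1 j - X j‖ ^ 2 =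
      ∑ j, ‖z.1 j‖ ^ 2 + ∑ j, ‖X j‖ ^ 2 - 2 * (∑ j, z.1 j * conj (X j)).re := by
    rw [Complex.re_sum, Finset.mul_sum, ← Finset.sum_add_distrib, ← Finset.sum_sub_distrib]
    refine Finset.sum_congr rfl fun j _ => ?_
    simp only [← Complex.normSq_eq_norm_sq, Complex.normSq_sub]
  have h2 := Complex.abs_re_le_norm (herm (emb z.1) (emb X))
  have h3 : (herm (emb z.1) (emb X)).re = (∑ j, z.1 j * conj (X j)).re - 1 := by
    simp [herm, emb]
  rw [h3] at h2
  have h4 := neg_abs_le ((∑ j, z.1 j * conj (X j)).re - 1)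
  have h5 := z.2
  rw [h1, hX]
  linarith

theorem exists_pos_le_norm_herm_add {X Y : Fin n → ℂ} (hX : ∑ j, ‖X j‖ ^ 2 = 1)
    (hY : ∑ j, ‖Y j‖ ^ 2 = 1) (hXY : X ≠ Y) :
    ∃ ε : ℝ, 0 < ε ∧
      ∀ z : Ball n, ε ≤ ‖herm (emb z.1) (emb X)‖ + ‖herm (emb z.1) (emb Y)‖ := by
  obtain ⟨i, hi⟩ := Function.ne_iff.mp hXY
  -- The 4 comes from `|Xᵢ - Yᵢ|² ≤ 2 (|zᵢ - Xᵢ|² + |zᵢ - Yᵢ|²)` and the factor 2 in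
  -- `sum_norm_sub_sq_le`.
  refine ⟨‖X i - Y i‖ ^ 2 / 4, by have := norm_pos_iff.mpr (sub_ne_zero.mpr hi); positivity,
    fun z => ?_⟩
  have h1 := sum_norm_sub_sq_le hX z
  have h2 := sum_norm_sub_sq_le hY z
  have h3 : ∀ W : Fin n → ℂ, ‖z.1 i - W i‖ ^ 2 ≤ ∑ j, ‖z.1 j - W j‖ ^ 2 := fun W =>
    Finset.single_le_sum (f := fun j => ‖z.1 j - W j‖ ^ 2) (fun j _ => by positivity)
      (Finset.mem_univ i)
  have h4 : ‖X i - Y i‖ ≤ ‖z.1 i - X i‖ + ‖z.1 i - Y i‖ := by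
    have := norm_sub_le (z.1 i - Y i) (z.1 i - X i)
    rw [sub_sub_sub_cancel_left] at this
    linarith
  have h5 := h3 X
  have h6 := h3 Y
  nlinarith [norm_nonneg (X i - Y i), sq_nonneg (‖z.1 i - X i‖ - ‖z.1 i - Y i‖)]

theorem exists_norm_seed_le {X Y : Fin n → ℂ} (hX : ∑ j, ‖X j‖ ^ 2 = 1)
    (hY : ∑ j, ‖Y j‖ ^ 2 = 1) (hXY : X ≠ Y) (m : ℕ) (c₀ p : ℝ) :
    ∃ C : ℝ, ∀ z : Ball n, heightLog X Y z ∈ Set.Ico c₀ (c₀ + p) → ‖seed m X Y z‖ ≤ C := by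
  obtain ⟨ε, hε, h⟩ := exists_pos_le_norm_herm_add hX hY hXY
  set R₁ := Real.exp (c₀ + p)
  set R₂ := Real.exp (-c₀)
  have hR₁ : 0 < R₁ := Real.exp_pos _
  have hR₂ : 0 < R₂ := Real.exp_pos _
  -- With `x = |⟨z,X⟩|` and `y = |⟨z,Y⟩|`, the slab gives `x ≤ R₁ y` and `y ≤ R₂ x`. Since `x + y ≥
  -- ε`, neither can be small.
  refine ⟨((ε / (1 + R₂) * (ε / (1 + R₁))) ^ m)⁻¹, fun z hz => ?_⟩
  have hx := norm_herm_emb_pos hX z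
  have hy := norm_herm_emb_pos hY z
  have hxy := h z
  rw [seed, norm_inv, norm_pow, quad, norm_mul]
  rw [heightLog] at hz
  generalize ‖herm (emb z.1) (emb X)‖ = x at *
  generalize ‖herm (emb z.1) (emb Y)‖ = y at *
  have h1 : x ≤ R₁ * y := by
    have := (Real.log_lt_iff_lt_exp (by positivity)).mp hz.2
    rw [div_lt_iff₀ hy] at this
    exact this.le
  have h2 : y ≤ R₂ * x := by
    have := (Real.le_log_iff_exp_le (by positivity)).mp hz.1
    rw [le_div_iff₀ hy] at this
    have e : R₂ * Real.exp c₀ = 1 := by rw [← Real.exp_add]; simp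
    calc y = R₂ * (Real.exp c₀ * y) := by rw [← mul_assoc, e, one_mul]
      _ ≤ _ := by gcongr
  gcongr
  · rw [div_le_iff₀ (by positivity)]; linarith
  · rw [div_le_iff₀ (by positivity)]; linarith

/-- For `m ≥ n + 1` this power absorbs the denominator of the invariant density, leaving a bounded
function on a set of finite Lebesgue measure. -/
theorem integrable_one_sub_sum_pow {m : ℕ} (hm : n + 1 ≤ m) :
    Integrable (fun z : Ball n => ((1 - ∑ j, ‖z.1 j‖ ^ 2 : ℝ) : ℂ) ^ m) (hypVolume n) := by
  have hB := (isOpen_unitBall n).measurableSet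
  rw [integrable_hypVolume_iff fun z => ((1 - ∑ j, ‖z j‖ ^ 2 : ℝ) : ℂ) ^ m]
  have h : ∀ z ∈ unitBall n, (hypDensity n z : ℂ) * ((1 - ∑ j, ‖z j‖ ^ 2 : ℝ) : ℂ) ^ m =
      4 ^ n * ((1 - ∑ j, ‖z j‖ ^ 2 : ℝ) : ℂ) ^ (m - (n + 1)) := by
    intro z hz
    have h3 : ((1 - ∑ j, ‖z j‖ ^ 2 : ℝ) : ℂ) ≠ 0 :=
      Complex.ofReal_ne_zero.mpr (sub_pos.mpr hz).ne'
    obtain ⟨k, rfl⟩ := Nat.exists_eq_add_of_le hm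
    simp only [hypDensity]
    rw [Complex.ofReal_div, Complex.ofReal_pow, Complex.ofReal_pow, Nat.add_sub_cancel_left]
    generalize ((1 - ∑ j, ‖z j‖ ^ 2 : ℝ) : ℂ) = r at h3 ⊢
    rw [Complex.ofReal_ofNat]
    field_simp
    ring
  rw [integrableOn_congr_fun h hB]
  refine IntegrableOn.of_bound (volume_unitBall_lt_top n) ?_ (4 ^ n) ?_
  · exact Continuous.aestronglyMeasurable (by fun_prop)
  · filter_upwards [ae_restrict_mem hB] with z hz
    have h3 : 0 ≤ 1 - ∑ j, ‖z j‖ ^ 2 := sub_nonneg.mpr (le_of_lt hz)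
    have h4 : 0 ≤ ∑ j, ‖z j‖ ^ 2 := Finset.sum_nonneg fun _ _ => by positivity
    rw [norm_mul, norm_pow, norm_pow, Complex.norm_real, Real.norm_of_nonneg h3]
    have := pow_le_one₀ (n := m - (n + 1)) h3 (by linarith)
    norm_num
    exact this

variable {μ : Measure (SU n)}

theorem integrableOn_lift_seed (hμ : μ.map (fun g => g • origin n) = hypVolume n) {m : ℕ}
    (hm : n + 1 ≤ m) {X Y : Fin n → ℂ} (hX : ∑ j, ‖X j‖ ^ 2 = 1) (hY : ∑ j, ‖Y j‖ ^ 2 = 1)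
    (hXY : X ≠ Y) (c₀ p : ℝ) :
    IntegrableOn (lift (2 * m) (seed m X Y))
      {x : SU n | heightLog X Y (x • origin n) ∈ Set.Ico c₀ (c₀ + p)} μ := by
  obtain ⟨C, hC⟩ := exists_norm_seed_le hX hY hXY m c₀ p
  have hmeas := (continuous_smul_origin n).measurable
  have h1 : Integrable (fun x : SU n =>
      ((1 - ∑ j, ‖(x • origin n).1 j‖ ^ 2 : ℝ) : ℂ) ^ m) μ := by
    have h := integrable_one_sub_sum_pow hm
    rw [← hμ] at h
    exact h.comp_measurable hmeas
  have hset : MeasurableSet {x : SU n | heightLog X Y (x • origin n) ∈ Set.Ico c₀ (c₀ + p)} :=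
    ((measurable_heightLog X Y).comp hmeas) measurableSet_Ico
  refine (h1.norm.const_mul C).integrableOn.mono'
    (continuous_lift _ (continuous_seed m hX hY)).measurable.aestronglyMeasurable ?_
  filter_upwards [ae_restrict_mem hset] with x hx
  have h3 : 0 ≤ 1 - ∑ j, ‖(x • origin n).1 j‖ ^ 2 := sub_nonneg.mpr (x • origin n).2.le
  rw [norm_lift, norm_pow, Complex.norm_real, Real.norm_of_nonneg h3]
  gcongr
  exact hC _ hx

end Unfolded

/-! ### The unfolded integral for an arbitrary axis. -/

section PeriodFormula

variable {n : ℕ}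

theorem slash_seed_eq_seed {γ : SU n} {X Y : Fin n → ℂ} {lam : ℂ} (hlam : lam ≠ 0)
    (hγX : mat γ *ᵥ emb X = (conj lam)⁻¹ • emb X) (hγY : mat γ *ᵥ emb Y = lam • emb Y) {m : ℕ}
    (hreal : (lam / conj lam) ^ m = 1) : slash (2 * m) (seed m X Y) γ = seed m X Y := by
  have hc : conj lam ≠ 0 := (map_ne_zero _).mpr hlam
  have eX : emb X = conj lam • mat γ *ᵥ emb X := by rw [hγX, smul_inv_smul₀ hc]
  have eY : emb Y = lam⁻¹ • mat γ *ᵥ emb Y := by rw [hγY, inv_smul_smul₀ hlam]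
  funext z
  rw [slash_seed, seed, quad]
  have h1 : herm (mat γ *ᵥ emb z.1) (emb X) = lam * herm (emb z.1) (emb X) := by
    conv_lhs => rw [eX]
    rw [herm_smul_right, herm_mat, Complex.conj_conj]
  have h2 : herm (mat γ *ᵥ emb z.1) (emb Y) = (conj lam)⁻¹ * herm (emb z.1) (emb Y) := by
    conv_lhs => rw [eY]
    rw [herm_smul_right, herm_mat, map_inv₀]
  rw [h1, h2, show lam * herm (emb z.1) (emb X) * ((conj lam)⁻¹ * herm (emb z.1) (emb Y)) =
    lam / conj lam * (herm (emb z.1) (emb X) * herm (emb z.1) (emb Y)) by ring, mul_pow, hreal,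
    one_mul]

theorem lift_relPoincare {Γ : Subgroup (SU n)} (γ₀ : Γ) (k : ℕ) (q : Ball n → ℂ) (x : SU n) :
    lift k (relPoincare γ₀ k q) x = ∑' c : Cosets γ₀, lift k q ((c.out : SU n) * x) := by
  simp only [lift_mul]
  rw [lift, relPoincare, ← tsum_mul_right]
  rfl

theorem ne_of_fixedPoints {γ : SU n} {X Y : Fin n → ℂ} {lam : ℂ} (hlam : 1 < ‖lam‖)
    (hγX : mat γ *ᵥ emb X = (conj lam)⁻¹ • emb X) (hγY : mat γ *ᵥ emb Y = lam • emb Y) :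
    X ≠ Y := by
  rintro rfl
  have h := congrArg norm (smul_left_injective ℂ (emb_ne_zero X) (hγX.symm.trans hγY))
  rw [norm_inv, RCLike.norm_conj] at h
  have := inv_lt_one_of_one_lt₀ hlam
  linarith

section Axis

variable [NeZero n]

/-- In the coordinates of `g` the two products are proportional to `1 + w` and `1 - w`. The lower
end of the interval is the height of `g(0)`. -/
theorem heightLog_axis {g : SU n} {X Y : Fin n → ℂ} (hX : ∑ j, ‖X j‖ ^ 2 = 1)
    (hY : ∑ j, ‖Y j‖ ^ 2 = 1) {a b : ℂ} (ha : emb X = a • mat g *ᵥ diskVec n (-1) 1)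
    (hb : emb Y = b • mat g *ᵥ diskVec n 1 1) {s : ℝ} (z : Ball n) :
    heightLog X Y (g • z) ∈ Set.Ico (Real.log (‖a‖ / ‖b‖)) (Real.log (‖a‖ / ‖b‖) + 2 * s) ↔
      z.1 (lastIdx n) ∈ discSector s := by
  have ha0 : a ≠ 0 := fun h => emb_ne_zero X (by rw [ha, h, zero_smul])
  have hb0 : b ≠ 0 := fun h => emb_ne_zero Y (by rw [hb, h, zero_smul])
  have ha1 := norm_pos_iff.mpr ha0
  have hb1 := norm_pos_iff.mpr hb0
  have hj := norm_pos_iff.mpr (autFactor_ne_zero g z)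
  have key : ∀ (W : Fin n → ℂ) (e u : ℂ), emb W = e • mat g *ᵥ diskVec n u 1 →
      ‖herm (emb (g • z).1) (emb W)‖ =
        ‖autFactor g z‖ * (‖e‖ * ‖z.1 (lastIdx n) * conj u - 1‖) := by
    intro W e u h
    rw [h, mat_smul_emb, herm_smul_left, herm_smul_right, herm_mat, herm_diskVec_right]
    simp [emb]
  have hx := norm_herm_emb_pos hX (g • z)
  have hy := norm_herm_emb_pos hY (g • z)
  rw [key X a _ ha] at hx
  rw [key Y b _ hb] at hy
  have e1 : ‖z.1 (lastIdx n) * conj (-1 : ℂ) - 1‖ = ‖1 + z.1 (lastIdx n)‖ := by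
    rw [map_neg, map_one, ← norm_neg]; congr 1; ring
  have e2 : ‖z.1 (lastIdx n) * conj (1 : ℂ) - 1‖ = ‖1 - z.1 (lastIdx n)‖ := by
    rw [map_one, mul_one, norm_sub_rev]
  rw [heightLog, key X a _ ha, key Y b _ hb]
  rw [e1] at hx ⊢
  rw [e2] at hy ⊢
  have hx' : 0 < ‖1 + z.1 (lastIdx n)‖ :=
    pos_of_mul_pos_right (pos_of_mul_pos_right hx hj.le) ha1.le
  have hy' : 0 < ‖1 - z.1 (lastIdx n)‖ :=
    pos_of_mul_pos_right (pos_of_mul_pos_right hy hj.le) hb1.le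
  have e3 : ‖autFactor g z‖ * (‖a‖ * ‖1 + z.1 (lastIdx n)‖) /
      (‖autFactor g z‖ * (‖b‖ * ‖1 - z.1 (lastIdx n)‖)) =
      ‖a‖ / ‖b‖ * (‖1 + z.1 (lastIdx n)‖ / ‖1 - z.1 (lastIdx n)‖) := by field_simp
  rw [e3, Real.log_mul (by positivity) (by positivity), Set.mem_Ico, le_add_iff_nonneg_right,
    add_lt_add_iff_left, Real.le_log_iff_exp_le (by positivity), Real.exp_zero, one_le_div hy',
    Real.log_lt_iff_lt_exp (by positivity), div_lt_iff₀ hy']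
  rfl

/-- On the disc, `c` acts as `tanh ζ ↦ tanh (ζ + s)` with automorphy factor `cosh ζ / (δ cosh (ζ +
s))`. Periodicity is thus the automorphy of `f` under `c`, once `δ^{2m} = 1`. -/
theorem stripLift_add {c : SU n} {s : ℝ} {δ : ℂ}
    (hc : ∀ u v, mat c *ᵥ diskVec n u v = δ • mat (flow n s) *ᵥ diskVec n u v) {m : ℕ}
    (hδ : δ ^ (2 * m) = 1) {f : Ball n → ℂ} (hf : slash (2 * m) f c = f) {F : (Fin n → ℂ) → ℂ}
    (hfF : ∀ z : Ball n, f z = F z.1) {ζ : ℂ} (hζ : |ζ.im| < Real.pi / 4) :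
    stripLift m (fun w => F (Pi.single (lastIdx n) w)) (ζ + s) =
      stripLift m (fun w => F (Pi.single (lastIdx n) w)) ζ := by
  have h1 := cosh_ne_zero_of_abs_im_lt hζ
  have h2 : Complex.cosh (ζ + s) ≠ 0 := cosh_ne_zero_of_abs_im_lt (by simpa using hζ)
  set z : Ball n := ⟨Pi.single (lastIdx n) (Complex.tanh ζ),
    single_mem_unitBall.mpr (norm_tanh_lt_one hζ)⟩ with hz
  have hv : mat c *ᵥ emb z.1 = (δ * (Complex.cosh (ζ + s) / Complex.cosh ζ)) •
      diskVec n (Complex.tanh (ζ + s)) 1 := by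
    rw [hz, emb_single, hc, flow_mulVec_diskVec, mul_smul,
      smul_diskVec (Complex.cosh (ζ + s) / Complex.cosh ζ)]
    congr 2
    · rw [Complex.tanh_eq_sinh_div_cosh, Complex.tanh_eq_sinh_div_cosh]
      field_simp
      rw [Complex.sinh_add]
      ring
    · rw [Complex.tanh_eq_sinh_div_cosh]
      field_simp
      rw [Complex.cosh_add]
      ring
  have hz0 := mat_emb_ne_zero c z
  have hinr : (mat c *ᵥ emb z.1) (Sum.inr ()) = δ * (Complex.cosh (ζ + s) / Complex.cosh ζ) := by
    rw [hv]; simp [diskVec]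
  have hcz : (c • z).1 = Pi.single (lastIdx n) (Complex.tanh (ζ + s)) := by
    have h := mat_emb c z
    rw [hinr] at h hz0
    rw [hv] at h
    have h' := smul_right_injective _ hz0 h
    funext i
    simpa [emb, diskVec] using (congrFun h' (Sum.inl i)).symm
  have hfz := congrFun hf z
  rw [slash, hfF, hfF, hcz, autFactor, hinr, inv_pow, mul_pow, hδ, one_mul] at hfz
  simp only [stripLift]
  rw [← hfz, div_pow]
  field_simp

theorem integral_axis {g : SU n} {X Y : Fin n → ℂ} {a b : ℂ}
    (ha : emb X = a • mat g *ᵥ diskVec n (-1) 1) (hb : emb Y = b • mat g *ᵥ diskVec n 1 1) {m : ℕ}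
    {f : Ball n → ℂ} {F : (Fin n → ℂ) → ℂ} (hF : ∀ z : Ball n, slash (2 * m) f g z = F z.1)
    (s : ℝ) :
    ∫ t in (0 : ℝ)..s, f ((g * flow n t) • origin n) * quad X Y ((g * flow n t) • origin n) ^ m =
      (conj a * conj b) ^ m *
        ∫ t in (0 : ℝ)..s, stripLift m (fun w => F (Pi.single (lastIdx n) w)) t := by
  rw [← intervalIntegral.integral_const_mul]
  refine intervalIntegral.integral_congr fun t _ => ?_
  have hcosh : Complex.cosh t ≠ 0 := cosh_ne_zero_of_abs_im_lt (by simp [Real.pi_pos])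
  rw [mul_smul, quad_pow_mul_autFactor, hF, ha, hb, herm_smul_right, herm_smul_right, herm_mat,
    herm_mat, flow_smul_origin, emb_single, herm_diskVec, herm_diskVec, Complex.ofReal_tanh,
    stripLift, pow_mul, ← inv_pow, ← one_sub_tanh_sq hcosh]
  simp only [map_neg, map_one]
  rw [show conj a * (Complex.tanh t * -1 - 1 * 1) * (conj b * (Complex.tanh t * 1 - 1 * 1)) =
    conj a * conj b * (1 - Complex.tanh t ^ 2) by ring, mul_pow]
  ring

variable {μ : Measure (SU n)} [μ.IsHaarMeasure]

/-- The unfolded integral, over a fundamental domain of the group generated by `γ`. -/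
theorem setIntegral_lift_mul_conj_lift_seed
    (hμ : μ.map (fun g => g • origin n) = hypVolume n) {m : ℕ} (hm : n + 1 ≤ m)
    {f : Ball n → ℂ} {F₀ : (Fin n → ℂ) → ℂ} (hF₀ : DifferentiableOn ℂ F₀ (unitBall n))
    (hfF₀ : ∀ z : Ball n, f z = F₀ z.1) {M : ℝ} (hM : ∀ x, ‖lift (2 * m) f x‖ ≤ M)
    {γ g : SU n} (hfγ : slash (2 * m) f γ = f) {s : ℝ} (hs : 0 < s) {X Y : Fin n → ℂ}
    (hX : ∑ j, ‖X j‖ ^ 2 = 1) (hY : ∑ j, ‖Y j‖ ^ 2 = 1) {a b δ : ℂ}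
    (ha : emb X = a • mat g *ᵥ diskVec n (-1) 1) (hb : emb Y = b • mat g *ᵥ diskVec n 1 1)
    (hc : ∀ u v, mat (g⁻¹ * γ * g) *ᵥ diskVec n u v = δ • mat (flow n s) *ᵥ diskVec n u v)
    (hδ : δ ^ (2 * m) = 1) :
    ∫ x in {x : SU n | heightLog X Y (x • origin n) ∈
        Set.Ico (Real.log (‖a‖ / ‖b‖)) (Real.log (‖a‖ / ‖b‖) + 2 * s)},
      lift (2 * m) f x * conj (lift (2 * m) (seed m X Y) x) ∂μ =
    ((‖-herm (emb X) (emb Y) / 2‖ : ℂ) ^ (2 * m))⁻¹ * (stdPeriodConst n m : ℂ) *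
      ∫ t in (0 : ℝ)..s, f ((g * flow n t) • origin n) *
        quad X Y ((g * flow n t) • origin n) ^ m := by
  have ha0 : a ≠ 0 := fun h => emb_ne_zero X (by rw [ha, h, zero_smul])
  have hb0 : b ≠ 0 := fun h => emb_ne_zero Y (by rw [hb, h, zero_smul])
  obtain ⟨F, hF, hfF⟩ := exists_holomorphic_slash (2 * m) hF₀ hfF₀ g
  set f' := slash (2 * m) f g with hf'
  have hf'c : Continuous f' := continuous_of_holomorphic hF hfF
  -- The lift of `f|g` is a left translate of the lift of `f`, so the bound `M` is unchanged.
  have hMf' : ∀ z ∈ unitBall n, ‖F z‖ * (1 - ∑ j, ‖z j‖ ^ 2) ^ m ≤ M := by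
    intro z hz
    have h := norm_mul_le_of_lift_le hμ m hf'c (M := M)
      (fun x => by rw [hf', ← lift_mul]; exact hM _) ⟨z, hz⟩
    rwa [hfF] at h
  have hslash : slash (2 * m) f' (g⁻¹ * γ * g) = f' := by
    rw [hf', ← slash_mul, ← mul_assoc, mul_inv_cancel_left, slash_mul, hfγ]
  have hper := fun (ζ : ℂ) (hζ : |ζ.im| < Real.pi / 4) => stripLift_add hc hδ hslash hfF hζ
  set l := lastIdx n
  have hq : ∀ z : Ball n, slash (2 * m) (seed m X Y) g z =
      ((conj a * conj b) ^ m * (1 - z.1 l ^ 2) ^ m)⁻¹ := by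
    intro z
    rw [slash_seed, ha, hb, herm_smul_right, herm_smul_right, herm_mat, herm_mat,
      herm_diskVec_right, herm_diskVec_right, ← mul_pow]
    simp only [emb, Sum.elim_inl, Sum.elim_inr, map_neg, map_one]
    congr 2
    ring
  set ψ : Ball n → ℂ := fun z => F z.1 * ((((a * b) ^ m)⁻¹) * sectorWeight m s (z.1 l)) *
    ((1 - ∑ j, ‖z.1 j‖ ^ 2 : ℝ) : ℂ) ^ (2 * m) with hψ
  set D₀ := {x : SU n | heightLog X Y (x • origin n) ∈
        Set.Ico (Real.log (‖a‖ / ‖b‖)) (Real.log (‖a‖ / ‖b‖) + 2 * s)} with hD₀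
  have hmeas := (continuous_smul_origin n).measurable
  have hD₀m : MeasurableSet D₀ := ((measurable_heightLog X Y).comp hmeas) measurableSet_Ico
  have hpt : ∀ x : SU n, D₀.indicator (fun x => lift (2 * m) f x *
      conj (lift (2 * m) (seed m X Y) x)) (g * x) = ψ (x • origin n) := by
    intro x
    have hmem : g * x ∈ D₀ ↔ (x • origin n).1 l ∈ discSector s := by
      rw [hD₀, Set.mem_ofPred_eq, mul_smul]
      exact heightLog_axis hX hY ha hb _
    by_cases hx : (x • origin n).1 l ∈ discSector s
    · rw [Set.indicator_of_mem (hmem.mpr hx), lift_mul, lift_mul, lift_mul_conj_lift, hq,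
        ← hf', hfF]
      simp only [hψ, sectorWeight, Set.indicator_of_mem hx]
      rw [mul_inv, map_mul, map_inv₀, map_inv₀, map_pow, map_mul, Complex.conj_conj,
        Complex.conj_conj]
    · rw [Set.indicator_of_notMem (mt hmem.mp hx)]
      simp [hψ, sectorWeight, Set.indicator_of_notMem hx]
  have hψm : Measurable ψ := by
    have hl : Measurable fun z : Ball n => z.1 l :=
      ((continuous_apply l).comp continuous_subtype_val).measurable
    have hFm : Measurable fun z : Ball n => F z.1 := by
      rw [← funext hfF]; exact hf'c.measurable
    exact (hFm.mul (measurable_const.mul ((measurable_sectorWeight m s).comp hl))).mul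
      ((Complex.continuous_ofReal.comp
        (continuous_const.sub (continuous_sum_norm_sq n))).pow _).measurable
  calc _ = ∫ x, D₀.indicator (fun x => lift (2 * m) f x *
          conj (lift (2 * m) (seed m X Y) x)) x ∂μ := (integral_indicator hD₀m).symm
    _ = ∫ x, D₀.indicator (fun x => lift (2 * m) f x *
          conj (lift (2 * m) (seed m X Y) x)) (g * x) ∂μ := (integral_mul_left_eq_self _ g).symm
    _ = ∫ x, ψ (x • origin n) ∂μ := by simp only [hpt]
    _ = ∫ z, ψ z ∂(hypVolume n) := by
        rw [← hμ, integral_map hmeas.aemeasurable hψm.aestronglyMeasurable]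
    _ = _ := setIntegral_unitBall_period hm hF hMf' hs hper _
    _ = _ := by
        rw [integral_axis ha hb hfF]
        -- Here `α = a b̄`. The conjugated seed contributes `(ab)^{-m}` and the axis integral
        -- `(āb̄)^m`; together they account for `|α|^{-2m}`.
        have e1 : ((‖-herm (emb X) (emb Y) / 2‖ : ℝ) : ℂ) ^ (2 * m) =
            (a * b) ^ m * (conj a * conj b) ^ m := by
          have e2 : -herm (emb X) (emb Y) / 2 = a * conj b := by
            rw [ha, hb, herm_smul_left, herm_smul_right, herm_mat, herm_diskVec]
            simp only [map_one]
            ring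
          rw [e2, pow_mul, ← Complex.mul_conj', ← mul_pow, map_mul, Complex.conj_conj]
          ring
        have h1 : (conj a * conj b) ^ m ≠ 0 :=
          pow_ne_zero _ (mul_ne_zero ((map_ne_zero _).mpr ha0) ((map_ne_zero _).mpr hb0))
        rw [e1, mul_inv]
        field_simp

end Axis

end PeriodFormula

/-! ### Absolute convergence of the series and assembly of the period formula. -/

section Main

variable {n : ℕ}

/-- Fundamental domains are only null measurable, so `F` is replaced by a measurable set that agrees
with it almost everywhere. -/
theorem restrict_map_of_nullMeasurableSet {α β : Type*} [MeasurableSpace α] [MeasurableSpace β]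
    {μ : Measure α} {π : α → β} (hπ : Measurable π) {F : Set β}
    (hF : NullMeasurableSet F (μ.map π)) :
    (μ.map π).restrict F = (μ.restrict (π ⁻¹' F)).map π := by
  obtain ⟨F', hF', h⟩ := hF.exists_measurable_superset_ae_eq.imp fun _ h => h.2
  have hq : Measure.QuasiMeasurePreserving π μ (μ.map π) := ⟨hπ, Measure.AbsolutelyContinuous.rfl⟩
  rw [← Measure.restrict_congr_set h, Measure.restrict_map hπ hF',
    Measure.restrict_congr_set (hq.preimage_ae_eq h)]

variable {Γ : Subgroup (SU n)} {μ : Measure (SU n)}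

theorem isFundamentalDomain_preimage (hμ : μ.map (fun g => g • origin n) = hypVolume n)
    {F : Set (Ball n)} (hF : IsFundamentalDomain Γ F (hypVolume n)) :
    IsFundamentalDomain Γ ((fun g : SU n => g • origin n) ⁻¹' F) μ := by
  refine hF.preimage_of_equiv (e := id)
    ⟨(continuous_smul_origin n).measurable, hμ.le.absolutelyContinuous⟩ Function.bijective_id ?_
  intro γ g
  exact mul_smul (γ : SU n) g (origin n)

theorem lift_mul_of_slash_eq {k : ℕ} {f : Ball n → ℂ} {γ : SU n} (h : slash k f γ = f) (x : SU n) :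
    lift k f (γ * x) = lift k f x := by
  rw [lift_mul, h]

theorem apply_smul_zpowers {G α β : Type*} [Group G] [MulAction G α] {c : G} {u : α → β}
    (h : ∀ x, u (c • x) = u x) (g : Subgroup.zpowers c) (x : α) : u (g • x) = u x := by
  obtain ⟨_, k, rfl⟩ := g
  exact apply_zpow_smul h k x

theorem lift_mul_conj_lift_relPoincare {k : ℕ} {f : Ball n → ℂ} (hf : ∀ γ ∈ Γ, slash k f γ = f)
    (γ₀ : Γ) (q : Ball n → ℂ) (x : SU n) :
    lift k f x * conj (lift k (relPoincare γ₀ k q) x) =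
      ∑' c : Cosets γ₀, lift k f (c.out • x) * conj (lift k q (c.out • x)) := by
  rw [lift_relPoincare, Complex.conj_tsum, ← tsum_mul_left]
  refine tsum_congr fun c => ?_
  change _ = lift k f ((c.out : SU n) * x) * conj (lift k q ((c.out : SU n) * x))
  rw [lift_mul_of_slash_eq (hf _ c.out.2)]

/-- Unfolding gives summability of the lifted terms for almost every element of `D`. As `D` is not
null, one such `x` exists, and the comparison constant between `z` and `x(0)` is the same for all
cosets. -/
theorem summable_norm_slash_seed [μ.IsHaarMeasure] [Countable Γ]
    {D : Set (SU n)} (hD : IsFundamentalDomain Γ D μ) {m : ℕ} (γ₀ : Γ) {X Y : Fin n → ℂ}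
    (hX : ∑ j, ‖X j‖ ^ 2 = 1) (hY : ∑ j, ‖Y j‖ ^ 2 = 1) {D₀ : Set (SU n)}
    (hD₀ : IsFundamentalDomain (Subgroup.zpowers γ₀) D₀ μ)
    (hint : IntegrableOn (lift (2 * m) (seed m X Y)) D₀ μ)
    (hq : slash (2 * m) (seed m X Y) (γ₀ : SU n) = seed m X Y) (z : Ball n) :
    Summable fun c : Cosets γ₀ => ‖slash (2 * m) (seed m X Y) (c.out : SU n) z‖ := by
  have h := ae_summable_out hD hD₀ (apply_smul_zpowers fun x => lift_mul_of_slash_eq hq x) hint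
    (continuous_lift _ (continuous_seed m hX hY)).measurable
  have hD0 : μ.restrict D ≠ 0 := by
    rw [Ne, Measure.restrict_eq_zero]
    exact hD.measure_ne_zero (NeZero.ne μ)
  have : (ae (μ.restrict D)).NeBot := ae_neBot.mpr hD0
  obtain ⟨x, hx⟩ := h.exists
  obtain ⟨C, hC⟩ := exists_norm_slash_seed_le m hX hY z (x • origin n)
  have hj := pow_ne_zero (2 * m) (autFactor_ne_zero x (origin n))
  refine Summable.of_nonneg_of_le (fun _ => norm_nonneg _) (fun c => hC _) (Summable.mul_left C ?_)
  have h2 : ∀ c : Cosets γ₀, ‖slash (2 * m) (seed m X Y) (c.out : SU n) (x • origin n)‖ =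
      ‖lift (2 * m) (seed m X Y) (c.out • x)‖ * ‖autFactor x (origin n) ^ (2 * m)‖⁻¹ := by
    intro c
    have : lift (2 * m) (seed m X Y) (c.out • x) =
        slash (2 * m) (seed m X Y) (c.out : SU n) (x • origin n) *
          autFactor x (origin n) ^ (2 * m) := lift_mul _ _ (c.out : SU n) x
    rw [this, norm_mul, mul_inv_cancel_right₀ (norm_ne_zero_iff.mpr hj)]
  simp only [h2]
  exact hx.mul_right _

end Main

end ComplexHyperbolic

end

open ComplexHyperbolic in
theorem mainTheorem3 (n : ℕ) [NeZero n]
    (κ : ℚ) (hκ1 : 1 ≤ κ) (hκ2 : ∃ k : ℤ, 2 * κ = k)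
    (m : ℕ) (hm : (m : ℚ) = (n + 1) * κ)
    -- Haar measure on `SU(n,1)`, normalized so that it projects to `dV` on the ball
    (μ : Measure (SU n)) [μ.IsHaarMeasure]
    (hμ : μ.map (fun g => g • origin n) = hypVolume n)
    (Γ : Subgroup (SU n)) (hΓ : IsLattice μ Γ)
    (f : Ball n → ℂ) (hf : IsCuspForm Γ (2 * m) f)
    (γ₀ : Γ) (hγ₀ : IsLoxodromic (γ₀ : SU n))
    -- the repelling fixed point `X` and the attracting fixed point `Y` of `γ₀`
    (X Y : Fin n → ℂ) (hX : ∑ j, ‖X j‖ ^ 2 = 1) (hY : ∑ j, ‖Y j‖ ^ 2 = 1)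
    (lam : ℂ) (hlam : 1 < ‖lam‖)
    (hγX : mat (γ₀ : SU n) *ᵥ emb X = (conj lam)⁻¹ • emb X)
    (hγY : mat (γ₀ : SU n) *ᵥ emb Y = lam • emb Y)
    -- holds if `lam` is real
    (hreal : (lam / conj lam) ^ m = 1) :
    -- `q` is an automorphic form of weight `2m` for `⟨γ₀⟩`
    slash (2 * m) (seed m X Y) (γ₀ : SU n) = seed m X Y ∧
    -- the series `Θ` converges absolutely
    (∀ z : Ball n, Summable fun c : Cosets γ₀ =>
      ‖slash (2 * m) (seed m X Y) (c.out : SU n) z‖) ∧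
    -- for every geodesic parametrization `t ↦ g aₜ(0)` of the axis with `z₀ = g(0)` and
    -- `γ₀ z₀ = g aₛ(0)`, `s > 0`
    ∀ (L : Set (Ball n)) (z₀ : Ball n) (g : SU n) (s : ℝ),
      IsAxis (γ₀ : SU n) L → (fun z => g • z) '' stdGeodesic n = L → g • origin n = z₀ →
      0 < s → (g * flow n s) • origin n = (γ₀ : SU n) • z₀ →
      -- the product of the lifts over `Γ \ G`
      (∀ D : Set (SU n), IsFundamentalDomain Γ D μ →
        IntegrableOn (fun x => lift (2 * m) f x *
          conj (lift (2 * m) (relPoincare γ₀ (2 * m) (seed m X Y)) x)) D μ ∧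
        ∫ x in D, lift (2 * m) f x *
            conj (lift (2 * m) (relPoincare γ₀ (2 * m) (seed m X Y)) x) ∂μ
          = ((‖-herm (emb X) (emb Y) / 2‖ : ℂ) ^ (2 * m))⁻¹ * (periodConst n κ m : ℂ) *
            ∫ t in (0 : ℝ)..s, f ((g * flow n t) • origin n) *
              quad X Y ((g * flow n t) • origin n) ^ m) ∧
      -- the same product over `Γ \ Bⁿ`, when `Γ` acts effectively
      (∀ F : Set (Ball n), IsFundamentalDomain Γ F (hypVolume n) →
        IntegrableOn (fun z => f z * conj (relPoincare γ₀ (2 * m) (seed m X Y) z) *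
          ((1 - ∑ j, ‖z.1 j‖ ^ 2 : ℝ) : ℂ) ^ (2 * m)) F (hypVolume n) ∧
        ∫ z in F, f z * conj (relPoincare γ₀ (2 * m) (seed m X Y) z) *
            ((1 - ∑ j, ‖z.1 j‖ ^ 2 : ℝ) : ℂ) ^ (2 * m) ∂(hypVolume n)
          = ((‖-herm (emb X) (emb Y) / 2‖ : ℂ) ^ (2 * m))⁻¹ * (periodConst n κ m : ℂ) *
            ∫ t in (0 : ℝ)..s, f ((g * flow n t) • origin n) *
              quad X Y ((g * flow n t) • origin n) ^ m) := by
  have hmn : n + 1 ≤ m := by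
    have h : ((n + 1 : ℕ) : ℚ) ≤ m := by
      rw [hm]
      push_cast
      nlinarith [(Nat.cast_nonneg n : (0 : ℚ) ≤ n)]
    exact_mod_cast h
  have hlam0 : lam ≠ 0 := norm_ne_zero_iff.mp (by linarith)
  have hXY := ne_of_fixedPoints hlam hγX hγY
  have hq := slash_seed_eq_seed hlam0 hγX hγY hreal
  obtain ⟨hdisc, D₁, hD₁, -⟩ := hΓ
  have hcount : Countable Γ := countable_of_discrete Γ
  have hmeas := (continuous_smul_origin n).measurable
  obtain ⟨F₀, hF₀, hfF₀⟩ := hf.holomorphic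
  obtain ⟨M, hM⟩ := hf.bounded
  have hfc : Continuous f := continuous_of_holomorphic hF₀ hfF₀
  have hfγ := hf.slash_eq γ₀ γ₀.2
  have hlog : 0 < 2 * Real.log ‖lam‖ := by have := Real.log_pos hlam; positivity
  have hdom := fun c₀ : ℝ => isFundamentalDomain_zpowers (μ := μ) (γ := γ₀)
    ((measurable_heightLog X Y).comp hmeas) hlog (fun x => by
      have := heightLog_smul hX hY hlam0 hγX hγY (x • origin n)
      rw [smul_smul] at this
      exact this) c₀
  have hqint := fun c₀ : ℝ =>
    integrableOn_lift_seed hμ hmn hX hY hXY c₀ (2 * Real.log ‖lam‖)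
  have hqm := (continuous_lift (2 * m) (continuous_seed m hX hY)).measurable
  have hfm := (continuous_lift (2 * m) hfc).measurable
  have hsum := summable_norm_slash_seed hD₁ γ₀ hX hY (hdom 0) (hqint 0) hq
  refine ⟨hq, hsum, fun L z₀ g s hL hgL hz₀ hs hgs => ?_⟩
  subst hz₀ hgL
  obtain ⟨a, b, δ, ha, hb, hlamδ, hδ1, hc⟩ :=
    exists_axis_normal_form hX hY hlam hγX hγY hs hL.2 hgs
  have hlogs : Real.log ‖lam‖ = s := by
    rw [hlamδ, norm_mul, hδ1, one_mul, Complex.norm_real, Real.norm_of_nonneg (Real.exp_pos s).le,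
      Real.log_exp]
  -- Since `λ = δ eˢ` with `|δ| = 1`, the quotient `λ / λ̄` is `δ²`.
  have hδ : δ ^ (2 * m) = 1 := by
    have hδ0 : δ ≠ 0 := norm_ne_zero_iff.mp (by rw [hδ1]; exact one_ne_zero)
    have he : (Real.exp s : ℂ) ≠ 0 := Complex.ofReal_ne_zero.mpr (Real.exp_pos s).ne'
    have h1 : conj δ = δ⁻¹ := by
      refine eq_inv_of_mul_eq_one_left ?_
      rw [mul_comm, Complex.mul_conj', hδ1]; simp
    rw [← hreal, hlamδ, map_mul, Complex.conj_ofReal, h1, pow_mul]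
    congr 1
    field_simp
  set Φ : SU n → ℂ := fun x => lift (2 * m) f x * conj (lift (2 * m) (seed m X Y) x) with hΦ
  have hΦm : Measurable Φ := hfm.mul (Complex.continuous_conj.measurable.comp hqm)
  have hΦinv : ∀ (h : Subgroup.zpowers γ₀) x, Φ (h • x) = Φ x :=
    apply_smul_zpowers fun x => by
      change lift (2 * m) f ((γ₀ : SU n) * x) *
        conj (lift (2 * m) (seed m X Y) ((γ₀ : SU n) * x)) = _
      rw [lift_mul_of_slash_eq hfγ, lift_mul_of_slash_eq hq]
  have hΦint : ∀ c₀ : ℝ, IntegrableOn Φ _ μ := fun c₀ =>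
    Integrable.bdd_mul (c := M) (Complex.conjLIE.integrable_comp_iff.mpr (hqint c₀))
      hfm.aestronglyMeasurable (ae_of_all _ hM)
  have hperiod := setIntegral_lift_mul_conj_lift_seed hμ hmn hF₀ hfF₀ hM hfγ hs hX hY ha hb hc hδ
  rw [← hlogs] at hperiod
  rw [periodConst_eq hm, ← hlogs, ← hperiod]
  have hgroup : ∀ D : Set (SU n), IsFundamentalDomain Γ D μ →
      IntegrableOn (fun x => lift (2 * m) f x *
        conj (lift (2 * m) (relPoincare γ₀ (2 * m) (seed m X Y)) x)) D μ ∧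
      ∫ x in D, lift (2 * m) f x *
        conj (lift (2 * m) (relPoincare γ₀ (2 * m) (seed m X Y)) x) ∂μ =
        ∫ x in {x : SU n | heightLog X Y (x • origin n) ∈ Set.Ico (Real.log (‖a‖ / ‖b‖))
          (Real.log (‖a‖ / ‖b‖) + 2 * Real.log ‖lam‖)}, Φ x ∂μ := by
    intro D hD
    simp only [lift_mul_conj_lift_relPoincare hf.slash_eq γ₀]
    exact ⟨integrableOn_tsum_out hD (hdom (Real.log (‖a‖ / ‖b‖))) hΦinv (hΦint _) hΦm,
      setIntegral_tsum_out hD (hdom (Real.log (‖a‖ / ‖b‖))) hΦinv (hΦint _) hΦm⟩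
  refine ⟨hgroup, fun F hF => ?_⟩
  -- A fundamental domain in the ball pulls back along `g ↦ g(0)` to one in the group, so the
  -- formula on the ball is an instance of the one on the group.
  obtain ⟨h1, h2⟩ := hgroup _ (isFundamentalDomain_preimage hμ hF)
  have hΘ : Measurable (relPoincare γ₀ (2 * m) (seed m X Y)) :=
    Measurable.tsum fun c => (continuous_slash _ (continuous_seed m hX hY) _).measurable
  have hint : Measurable fun z : Ball n => f z * conj (relPoincare γ₀ (2 * m) (seed m X Y) z) *
      ((1 - ∑ j, ‖z.1 j‖ ^ 2 : ℝ) : ℂ) ^ (2 * m) :=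
    (hfc.measurable.mul (Complex.continuous_conj.measurable.comp hΘ)).mul
      ((Complex.continuous_ofReal.comp
        (continuous_const.sub (continuous_sum_norm_sq n))).pow _).measurable
  have hrestr : (hypVolume n).restrict F =
      (μ.restrict ((fun g : SU n => g • origin n) ⁻¹' F)).map fun g => g • origin n := by
    rw [← hμ]
    exact restrict_map_of_nullMeasurableSet hmeas (hμ ▸ hF.nullMeasurableSet)
  simp only [lift_mul_conj_lift] at h1 h2
  rw [IntegrableOn, hrestr, integrable_map_measure hint.aestronglyMeasurable hmeas.aemeasurable,
    integral_map hmeas.aemeasurable hint.aestronglyMeasurable]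
  exact ⟨h1, h2⟩
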